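/- **Turing machines.** Let $\mathcal S$ be a finite alphabet containing a blank symbol, $\mathcal Q$ a set of states containing a start state, and $\mathcal F$ a finite set of tuples $\langle q_i,s_1,s_2,d,q_j\rangle$ with $d\in\{L,R\}$ (in state $q_i$ reading $s_1$: write $s_2$, move the head one cell in direction $d$, enter state $q_j$). A tape $\mathcal T$ is a two-way infinite sequence of symbols with a marked head cell, considered up to translation. Write $\langle\mathcal T,q\rangle\to\langle\mathcal T',q'\rangle$ when some tuple of $\mathcal F$ performs this transition. **The calculus.** Processes of the synchronous polyadic $\pi$-calculus are the finite or infinite terms, up to $\alpha$-conversion, over $$P::=0\mid P\,|\,P\mid\ !P\mid(\nu n)P\mid a(\tilde x).P\mid\overline a\langle\tilde b\rangle.P\mid \mathsf{if}\ m=n\ \mathsf{then}\ P\ \mathsf{else}\ P .$$ Structural congruence $\equiv$ is the least congruence (finite derivations) with $P|0\equiv P$, $P|Q\equiv Q|P$, $P|(Q|R)\equiv(P|Q)|R$, $(\nu a)0\equiv0$, $(\nu a)(\nu b)P\equiv(\nu b)(\nu a)P$, $P|(\nu a)Q\equiv(\nu a)(P|Q)$ if $a\notin\mathrm{fn}(P)$,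 $!P\equiv P|{!P}$, $(\mathsf{if}\ m=m\ \mathsf{then}\ P\ \mathsf{else}\ Q)\equiv P$, and $(\mathsf{if}\ m=n\ \mathsf{then}\ P\ \mathsf{else}\ Q)\equiv Q$ if $m\neq n$, the last law being applicable only when neither $m$ nor $n$ is bound by an enclosing input. Reduction $\to$ is the closure of $\overline m\langle\tilde b\rangle.P\,|\,m(\tilde x).Q\to P\,|\,\{b_i/x_i\}Q$ (for $|\tilde b|=|\tilde x|$) under parallel composition, restriction and $\equiv$. **The encoding.** Choose pairwise distinct free names $s$ for $s\in\mathcal S$ and $qs$ for $(q,s)\in\mathcal Q\times\mathcal S$. For a channel $c$ and a sequence of symbols $s_1,s_2,\dots$ let $$C_c(s_1,s_2,\dots)=(\nu x_1)\big(\overline c\langle s_1,x_1\rangle\,|\,(\nu x_2)(\overline{x_1}\langle s_2,x_2\rangle\,|\,(\nu x_3)(\overline{x_2}\langle s_3,x_3\rangle\,|\,\cdots))\big).$$ For a tape $\mathcal T=\dots a_2,a_1,\mathbf h,b_1,b_2,\dots$ (head on $h$) put $$[\![\langle\mathcal T,q\rangle]\!]=(\nu l)(\nu r)\big(\overline{qh}\langle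 l,r\rangle\,|\,C_l(a_1,a_2,\dots)\,|\,C_r(b_1,b_2,\dots)\,|\,\textstyle\prod_{u\in\mathcal F}!\,[\![u]\!]\big),$$ where $$[\![\langle q_i,s_1,s_2,L,q_j\rangle]\!]=q_is_1(l_c,r_c).\,l_c(s_c,l_1).\,(\nu r_1)\big(D_{q_j}(s_c;l_1,r_1)\,|\,\overline{r_1}\langle s_2,r_c\rangle\big),$$ $$[\![\langle q_i,s_1,s_2,R,q_j\rangle]\!]=q_is_1(l_c,r_c).\,r_c(s_c,r_1).\,(\nu l_1)\big(D_{q_j}(s_c;l_1,r_1)\,|\,\overline{l_1}\langle s_2,l_c\rangle\big),$$ and $D_q(x;l,r)$ is $\mathsf{if}\ x=s_{0}\ \mathsf{then}\ \overline{qs_{0}}\langle l,r\rangle\ \mathsf{else}\ \mathsf{if}\ x=s_{1}\ \mathsf{then}\ \overline{qs_{1}}\langle l,r\rangle\ \mathsf{else}\cdots\mathsf{else}\ 0$, running through all symbols of $\mathcal S$. **Theorem.** For every such machine and every configuration $c=\langle\mathcal T,q\rangle$: 1. for every configuration $c'$: $c\to c'$ if and only if there are exactly two successive reductions $[\![c]\!]\to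 P\to Q$, for some $P$ and $Q$, with $Q\equiv[\![c']\!]$; 2. there is an infinite sequence of transitions from $c$ if and only if there is an infinite sequence of reductions from $[\![c]\!]$; 3. the encoding is not faithful: whenever $[\![c]\!]\to P$ is a single reduction, $P\not\equiv[\![c']\!]$ for every configuration $c'$ (in particular for every successor $c'$ of $c$). -/

import Mathlib

namespace PiTM

universe u v w

/-! ## Turing machines -/

/-- A transition tuple `⟨q₁, s₂, s₃, d₄, q₅⟩`: in state `src`, reading `read`, write `write`,
move the head in direction `dir`, and enter state `dst`. -/
structure Transition (S : Type u) (Q : Type v) where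
  src : Q
  read : S
  write : S
  dir : Turing.Dir
  dst : Q

/-- A Turing machine over the alphabet `S` and the states `Q`. Neither determinism nor totality of
the transition relation on non-terminating states is imposed. -/
structure TuringMachine (S : Type u) (Q : Type v) where
  blank : S
  start : Q
  transitions : Finset (Transition S Q)

/-- A two-way infinite tape with a marked head cell. `left` and `right` list the cells on the two
sides of the head, the cell nearest to the head first. -/
structure Tape (S : Type u) where
  left : Stream' S
  head : S
  right : Stream' S

/-- Write `s` in the head cell, then move the head one cell. -/
def Tape.writeMove {S : Type u} (t : Tape S) (s : S) : Turing.Dir → Tape S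
  | .left => ⟨t.left.tail, t.left.head, Stream'.cons s t.right⟩
  | .right => ⟨Stream'.cons s t.left, t.right.head, t.right.tail⟩

/-- The current tape and the current state. -/
structure Config (S : Type u) (Q : Type v) where
  tape : Tape S
  state : Q

/-- One transition of the machine. -/
def TuringMachine.Step {S : Type u} {Q : Type v} (M : TuringMachine S Q)
    (c c' : Config S Q) : Prop :=
  ∃ t ∈ M.transitions, t.src = c.state ∧ t.read = c.tape.head ∧
    c' = ⟨c.tape.writeMove t.write t.dir, t.dst⟩

/-! ## Names -/

/-- Names of the calculus: a free name, or a de Bruijn index that refers to an enclosing binder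
(restriction or input). Processes are thereby taken up to `α`-conversion. -/
inductive Nm (N : Type w) : Type w
  | free (a : N)
  | bound (k : ℕ)

namespace Nm

variable {N : Type w}

/-- Weakening by `j` binders. -/
def shift (j : ℕ) : Nm N → Nm N
  | free a => free a
  | bound k => bound (k + j)

/-- Apply a substitution of names for indices. -/
def subst (σ : ℕ → Nm N) : Nm N → Nm N
  | free a => free a
  | bound k => σ k

/-- A substitution transported under `j` binders. -/
def lift (j : ℕ) (σ : ℕ → Nm N) : ℕ → Nm N :=
  fun k => if k < j then bound k else (σ (k - j)).shift j

/-- The substitution that replaces the `bs.length` innermost indices by the names `bs`. -/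
def inst (bs : List (Nm N)) : ℕ → Nm N :=
  fun k => bs.getD k (bound (k - bs.length))

/-- The substitution that exchanges the two innermost indices. -/
def swap : ℕ → Nm N
  | 0 => bound 1
  | 1 => bound 0
  | k + 2 => bound (k + 2)

/-- `m` is not one of the indices in `V`. -/
def NotIn (V : Set ℕ) : Nm N → Prop
  | free _ => True
  | bound k => k ∉ V

end Nm

/-! ## Processes of the synchronous polyadic π-calculus, with name comparison -/

/-- The node labels of the syntax trees. -/
inductive Node (N : Type w) : Type w
  | nil
  | par
  | repl
  | res
  | inp (a : Nm N) (n : ℕ)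
  | out (a : Nm N) (bs : List (Nm N))
  | ite (m n : Nm N)

/-- The index type of the immediate subterms below a node. -/
def Node.Child {N : Type w} : Node N → Type
  | nil => Empty
  | par => Bool
  | repl => Unit
  | res => Unit
  | inp _ _ => Unit
  | out _ _ => Unit
  | ite _ _ => Bool

/-- The signature of the calculus. -/
def sig (N : Type w) : PFunctor.{w, 0} := ⟨Node N, Node.Child⟩

/-- Processes: finite and infinite syntax trees over the signature. -/
def Proc (N : Type w) : Type w := (sig N).M

namespace Proc

variable {N : Type w}

/-- The null process. -/
def nil : Proc N := PFunctor.M.mk (F := sig N) ⟨Node.nil, Empty.elim⟩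

/-- Parallel composition `P | Q`. -/
def par (P Q : Proc N) : Proc N :=
  PFunctor.M.mk (F := sig N) ⟨Node.par, fun b => cond b P Q⟩

/-- Replication `!P`. -/
def repl (P : Proc N) : Proc N := PFunctor.M.mk (F := sig N) ⟨Node.repl, fun _ => P⟩

/-- Restriction `(ν x) P`; the restricted name is the index `0` in `P`. -/
def res (P : Proc N) : Proc N := PFunctor.M.mk (F := sig N) ⟨Node.res, fun _ => P⟩

/-- Input `a(x₀, …, xₙ₋₁).P`; the binding name `xᵢ` is the index `i` in `P`. -/
def inp (a : Nm N) (n : ℕ) (P : Proc N) : Proc N :=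
  PFunctor.M.mk (F := sig N) ⟨Node.inp a n, fun _ => P⟩

/-- Output `a⟨bs⟩.P`. -/
def out (a : Nm N) (bs : List (Nm N)) (P : Proc N) : Proc N :=
  PFunctor.M.mk (F := sig N) ⟨Node.out a bs, fun _ => P⟩

/-- `if m = n then P else Q`. -/
def ite (m n : Nm N) (P Q : Proc N) : Proc N :=
  PFunctor.M.mk (F := sig N) ⟨Node.ite m n, fun b => cond b P Q⟩

/-- One layer of substitution. -/
def substStep (x : (ℕ → Nm N) × Proc N) : (sig N).Obj ((ℕ → Nm N) × Proc N) :=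
  match PFunctor.M.dest (F := sig N) x.2 with
  | ⟨.nil, _⟩ => ⟨Node.nil, Empty.elim⟩
  | ⟨.par, f⟩ => ⟨Node.par, fun i => (x.1, f i)⟩
  | ⟨.repl, f⟩ => ⟨Node.repl, fun i => (x.1, f i)⟩
  | ⟨.res, f⟩ => ⟨Node.res, fun i => (Nm.lift 1 x.1, f i)⟩
  | ⟨.inp a n, f⟩ => ⟨Node.inp (a.subst x.1) n, fun i => (Nm.lift n x.1, f i)⟩
  | ⟨.out a bs, f⟩ => ⟨Node.out (a.subst x.1) (bs.map (Nm.subst x.1)), fun i => (x.1, f i)⟩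
  | ⟨.ite m n, f⟩ => ⟨Node.ite (m.subst x.1) (n.subst x.1), fun i => (x.1, f i)⟩

/-- Capture-avoiding substitution of names for indices. -/
def subst (σ : ℕ → Nm N) (P : Proc N) : Proc N :=
  PFunctor.M.corec (F := sig N) substStep (σ, P)

/-- Weakening by one binder. -/
def weaken (P : Proc N) : Proc N := P.subst fun k => Nm.bound (k + 1)

/-- Parallel composition of a finite list of processes. -/
def parList (l : List (Proc N)) : Proc N := l.foldr par nil

end Proc

/-! ## Structural congruence and reduction -/

variable {N : Type w}

/-- The input-bound indices of `V`, seen from under one restriction. -/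
def underRes (V : Set ℕ) : Set ℕ := {k | 1 ≤ k ∧ k - 1 ∈ V}

/-- The input-bound indices of `V`, seen from under an input of `n` names, together with
these `n` names. -/
def underInp (n : ℕ) (V : Set ℕ) : Set ℕ := {k | k < n ∨ k - n ∈ V}

/-- Structural congruence below the input-bound names `V`. The law for unequal names is
restricted to names outside `V`: a name that is bound by an enclosing input is a
placeholder that may still be instantiated by any name. -/
inductive CongUnder : Set ℕ → Proc N → Proc N → Prop
  | refl (V : Set ℕ) (P : Proc N) : CongUnder V P P
  | symm {V : Set ℕ} {P Q : Proc N} : CongUnder V P Q → CongUnder V Q P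
  | trans {V : Set ℕ} {P Q R : Proc N} : CongUnder V P Q → CongUnder V Q R → CongUnder V P R
  | par_congr {V : Set ℕ} {P P' : Proc N} (Q : Proc N) : CongUnder V P P' → CongUnder V (P.par Q) (P'.par Q)
  | repl_congr {V : Set ℕ} {P P' : Proc N} : CongUnder V P P' → CongUnder V P.repl P'.repl
  | res_congr {V : Set ℕ} {P P' : Proc N} : CongUnder (underRes V) P P' → CongUnder V P.res P'.res
  | inp_congr {V : Set ℕ} {P P' : Proc N} (a : Nm N) (n : ℕ) : CongUnder (underInp n V) P P' →
      CongUnder V (Proc.inp a n P) (Proc.inp a n P')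
  | out_congr {V : Set ℕ} {P P' : Proc N} (a : Nm N) (bs : List (Nm N)) : CongUnder V P P' →
      CongUnder V (Proc.out a bs P) (Proc.out a bs P')
  | ite_congr {V : Set ℕ} {P P' Q Q' : Proc N} (m n : Nm N) : CongUnder V P P' → CongUnder V Q Q' →
      CongUnder V (Proc.ite m n P Q) (Proc.ite m n P' Q')
  | par_nil (V : Set ℕ) (P : Proc N) : CongUnder V (P.par Proc.nil) P
  | par_comm (V : Set ℕ) (P Q : Proc N) : CongUnder V (P.par Q) (Q.par P)
  | par_assoc (V : Set ℕ) (P Q R : Proc N) : CongUnder V (P.par (Q.par R)) ((P.par Q).par R)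
  | res_nil (V : Set ℕ) : CongUnder V Proc.nil.res Proc.nil
  | res_comm (V : Set ℕ) (P : Proc N) : CongUnder V P.res.res (P.subst Nm.swap).res.res
  | scope (V : Set ℕ) (P Q : Proc N) : CongUnder V (P.par Q.res) (P.weaken.par Q).res
  | unfold (V : Set ℕ) (P : Proc N) : CongUnder V P.repl (P.par P.repl)
  | ite_eq (V : Set ℕ) (m : Nm N) (P Q : Proc N) : CongUnder V (Proc.ite m m P Q) P
  | ite_ne {V : Set ℕ} {m n : Nm N} (P Q : Proc N) : m ≠ n → m.NotIn V → n.NotIn V →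
      CongUnder V (Proc.ite m n P Q) Q

/-- Structural congruence `P ≡ Q`. -/
def StructCong (P Q : Proc N) : Prop := CongUnder ∅ P Q

/-- The reduction relation: the communication axiom closed under parallel composition,
restriction and structural congruence. -/
inductive Red : Proc N → Proc N → Prop
  | comm (m : Nm N) (bs : List (Nm N)) (P Q : Proc N) :
      Red ((Proc.out m bs P).par (Proc.inp m bs.length Q)) (P.par (Q.subst (Nm.inst bs)))
  | par {P P' : Proc N} (Q : Proc N) : Red P P' → Red (P.par Q) (P'.par Q)
  | res {P P' : Proc N} : Red P P' → Red P.res P'.res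
  | struct {P Q Q' P' : Proc N} : StructCong P Q → Red Q Q' → StructCong Q' P' → Red P P'

/-! ## The encoding -/

/-- States of the unfolding that generates the chain process. -/
inductive ChainState (N : Type w) : Type w
  | chain (c : Nm N) (s : Stream' N)
  | link (c : Nm N) (s : Stream' N)
  | cell (c : Nm N) (a : N)
  | done

/-- One layer of the chain process. -/
def chainStep : ChainState N → (sig N).Obj (ChainState N)
  | .chain c s => ⟨Node.res, fun _ => .link (c.shift 1) s⟩
  | .link c s => ⟨Node.par, fun b => cond b (.cell c s.head) (.chain (Nm.bound 0) s.tail)⟩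
  | .cell c a => ⟨Node.out c [Nm.free a, Nm.bound 0], fun _ => .done⟩
  | .done => ⟨Node.nil, Empty.elim⟩

/-- The linked chain of restricted names with entry channel `c` and contents `s`, that is
`(ν x₁)(c⟨s₁, x₁⟩ | (ν x₂)(x₁⟨s₂, x₂⟩ | (ν x₃)(x₂⟨s₃, x₃⟩ | …)))`; see `chain_unfold`. -/
def chain (c : Nm N) (s : Stream' N) : Proc N :=
  PFunctor.M.corec (F := sig N) chainStep (.chain c s)

theorem chain_unfold (c : Nm N) (s : Stream' N) :
    chain c s = Proc.res ((Proc.out (c.shift 1) [Nm.free s.head, Nm.bound 0] Proc.nil).par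
      (chain (Nm.bound 0) s.tail)) := by
  have hdone : PFunctor.M.corec (F := sig N) chainStep .done = Proc.nil := by
    rw [PFunctor.M.corec_def]
    unfold Proc.nil
    congr 1
    refine Sigma.ext rfl (heq_of_eq ?_)
    funext i
    exact i.elim
  have hcell (c : Nm N) (a : N) : PFunctor.M.corec (F := sig N) chainStep (.cell c a) =
      Proc.out c [Nm.free a, Nm.bound 0] Proc.nil := by
    rw [PFunctor.M.corec_def, ← hdone]
    rfl
  have hlink (c : Nm N) (s : Stream' N) : PFunctor.M.corec (F := sig N) chainStep (.link c s) =
      (Proc.out c [Nm.free s.head, Nm.bound 0] Proc.nil).par (chain (Nm.bound 0) s.tail) := by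
    rw [PFunctor.M.corec_def, ← hcell]
    unfold Proc.par
    congr 1
    refine Sigma.ext rfl (heq_of_eq ?_)
    funext i
    cases i <;> rfl
  unfold chain
  rw [PFunctor.M.corec_def]
  change _ = Proc.res (Proc.par _ (chain _ _))
  rw [← hlink]
  rfl

section Encoding

variable {S : Type u} {Q : Type v}

/-- The free name of a symbol. -/
def symName (name : S ⊕ Q × S ↪ N) (s : S) : Nm N := Nm.free (name (Sum.inl s))

/-- The free name `q s` of a pair of a state and a symbol. -/
def chanName (name : S ⊕ Q × S ↪ N) (q : Q) (s : S) : Nm N := Nm.free (name (Sum.inr (q, s)))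

/-- The conditional
`if x = s₀ then (q s₀)⟨l, r⟩ else if x = s₁ then (q s₁)⟨l, r⟩ else … else 0`
through all symbols of the list. -/
def dispatch (name : S ⊕ Q × S ↪ N) (q : Q) (x l r : Nm N) (ss : List S) : Proc N :=
  ss.foldr (fun s P => Proc.ite x (symName name s)
    (Proc.out (chanName name q s) [l, r] Proc.nil) P) Proc.nil

/-- The encoding of a transition tuple. For a move to the left it is
`(q₁ s₂)(l_c, r_c). l_c(s_c, l₁). (ν r₁)(dispatch on s_c with (l₁, r₁) | r₁⟨s₃, r_c⟩)`.
Below the three binders the indices are: `0` is the restricted name, `1` is `s_c`, `2` is the name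
of the rest of the side that has been read, `3` is `l_c` and `4` is `r_c`. -/
noncomputable def encodeTransition [Fintype S] (name : S ⊕ Q × S ↪ N) (t : Transition S Q) : Proc N :=
  Proc.inp (chanName name t.src t.read) 2 <|
    match t.dir with
    | .left =>
      Proc.inp (Nm.bound 0) 2 <| Proc.res <|
        (dispatch name t.dst (Nm.bound 1) (Nm.bound 2) (Nm.bound 0) Finset.univ.toList).par
          (Proc.out (Nm.bound 0) [symName name t.write, Nm.bound 4] Proc.nil)
    | .right =>
      Proc.inp (Nm.bound 1) 2 <| Proc.res <|
        (dispatch name t.dst (Nm.bound 1) (Nm.bound 0) (Nm.bound 2) Finset.univ.toList).par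
          (Proc.out (Nm.bound 0) [symName name t.write, Nm.bound 3] Proc.nil)

/-- The encoding of the transition function: `∏ !⟦u⟧` over all tuples `u`. -/
noncomputable def encodeTransitions [Fintype S] (name : S ⊕ Q × S ↪ N) (M : TuringMachine S Q) :
    Proc N :=
  Proc.parList (M.transitions.toList.map fun t => (encodeTransition name t).repl)

/-- The encoding of the current state and the tape: `(q s_h)⟨l, r⟩ | ⟦left⟧_L | ⟦right⟧_R`. -/
def encodeTape (name : S ⊕ Q × S ↪ N) (l r : Nm N) (c : Config S Q) : Proc N :=
  (Proc.out (chanName name c.state c.tape.head) [l, r] Proc.nil).par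
    ((chain l (c.tape.left.map fun s => name (Sum.inl s))).par
      (chain r (c.tape.right.map fun s => name (Sum.inl s))))

/-- The encoding of a machine in a configuration: `(ν l)(ν r)(⟦tape⟧ | ⟦transitions⟧)`. -/
noncomputable def encode [Fintype S] (name : S ⊕ Q × S ↪ N) (M : TuringMachine S Q)
    (c : Config S Q) : Proc N :=
  Proc.res <| Proc.res <|
    (encodeTape name (Nm.bound 1) (Nm.bound 0) c).par (encodeTransitions name M)

end Encoding

/-- There is an infinite sequence of steps of `R` from `x`. -/
def Diverges {α : Type*} (R : α → α → Prop) (x : α) : Prop :=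
  ∃ f : ℕ → α, f 0 = x ∧ ∀ n, R (f n) (f (n + 1))

end PiTM

/-!
In a simulation every communication involves the unique process that holds the control of the
machine: the announcement of the configuration, which meets one of the enabled tuples, and then the
second input of that tuple, which meets the cell next to the head. Everything that has to be
excluded (other redexes, other decompositions of the infinite process modulo structural congruence,
two configurations with congruent encodings) is excluded by a type system whose judgement is
invariant under structural congruence and follows the reductions.

In the type system a bound name has as its type the stream of symbols that is stored in the chain
behind it. An output on a name of the type `s` has to send the symbol `s.head` together with a name
of the type `s.tail`; such outputs may occur without restraint. The control of the machine is
linear: there is at most one token, which is either `head c`, owned by the announcement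
`(q h)⟨l, r⟩` of the configuration `c`, or `pend t T`, owned by the second input of the encoding
of the tuple `t`, which is about to read a cell of the tape `T`. As processes may be infinite
trees, the judgement `Typed` is a greatest fixed point. The body of an input is required to be typed for all
names that the input may receive, in all extensions of the context, so that typing is stable under
injective renamings in both directions (`typed_ren_iff`). Name comparison is decided by the
identity of the names. This is sound because the law for distinct names is never applied to
input-bound ones: the substitutions of received names keep all other names distinct
(`CongUnder.typed_iff`).

A communication needs an output and an input on the same channel. The types leave two cases only,
and both of them move the token (`Red.typed`): `head c` becomes `pend t T` for a tuple `t` that is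
enabled in `c`, and `pend t T` becomes `head c'` for the successor `c'` determined by `t`. The
encoding of `c` is typed with the token `head c` (`typed_encode`) and with no other token
(`eq_head_of_typed_encode`), as the types of the two entry channels determine the content of the
two chains. Hence two reductions from the encoding of `c` can lead to the encoding of `c'` only if
`c'` is a successor of `c`, an infinite sequence of reductions gives an infinite sequence of
transitions, and the process between two reductions, which owns a token `pend t T`, is not
congruent to an encoding.

Conversely, each transition is simulated by two explicit reductions (`exists_red_red_left`,
`exists_red_red_right`). The equations between parallel compositions that occur there are solved in
the commutative monoid of processes modulo structural congruence.
-/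

namespace PiTM

universe u v w

/-! ### Substitution -/

namespace Nm

variable {N : Type w}

@[simp] theorem subst_free (σ : ℕ → Nm N) (a : N) : (free a).subst σ = free a := rfl

@[simp] theorem subst_bound (σ : ℕ → Nm N) (k : ℕ) : (bound k : Nm N).subst σ = σ k := rfl

@[simp] theorem shift_free (j : ℕ) (a : N) : (free a).shift j = free a := rfl

@[simp] theorem shift_bound (j k : ℕ) : (bound k : Nm N).shift j = bound (k + j) := rfl

@[simp] theorem subst_id (m : Nm N) : m.subst bound = m := by cases m <;> rfl

theorem subst_subst (σ τ : ℕ → Nm N) (m : Nm N) :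
    (m.subst σ).subst τ = m.subst fun k => (σ k).subst τ := by cases m <;> rfl

theorem shift_eq_subst (j : ℕ) (m : Nm N) : m.shift j = m.subst fun k => bound (k + j) := by
  cases m <;> rfl

@[simp] theorem lift_bound (j : ℕ) : lift j (bound : ℕ → Nm N) = bound := by
  funext k
  unfold lift
  split
  · rfl
  · simp; omega

@[simp] theorem lift_one_zero (σ : ℕ → Nm N) : lift 1 σ 0 = bound 0 := rfl

@[simp] theorem lift_one_succ (σ : ℕ → Nm N) (k : ℕ) : lift 1 σ (k + 1) = (σ k).shift 1 := by
  simp [lift]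

theorem shift_subst_lift (j : ℕ) (τ : ℕ → Nm N) (m : Nm N) :
    (m.shift j).subst (lift j τ) = (m.subst τ).shift j := by
  cases m <;> simp [lift]

theorem lift_comp (j : ℕ) (σ τ : ℕ → Nm N) :
    (fun k => (lift j σ k).subst (lift j τ)) = lift j fun k => (σ k).subst τ := by
  funext k
  by_cases h : k < j
  · simp [lift, h]
  · conv_lhs => simp only [lift, h, if_false]
    rw [shift_subst_lift]
    simp [lift, h]

end Nm

namespace Proc

variable {N : Type w}

/-- Every process is built by one of the constructors. -/
theorem cases_on_node {motive : Proc N → Prop} (P : Proc N) (nil : motive nil)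
    (par : ∀ A B, motive (par A B)) (repl : ∀ A, motive (repl A)) (res : ∀ A, motive (res A))
    (inp : ∀ a n A, motive (inp a n A)) (out : ∀ a bs A, motive (out a bs A))
    (ite : ∀ m n A B, motive (ite m n A B)) : motive P := by
  rw [← PFunctor.M.mk_dest (F := sig N) P]
  rcases PFunctor.M.dest (F := sig N) P with ⟨a, f⟩
  cases a with
  | nil =>
    have h : f = Empty.elim := funext fun i => i.elim
    subst h; exact nil
  | par =>
    have h : f = fun b => cond b (f true) (f false) := funext fun b => by cases b <;> rfl
    rw [h]; exact par _ _
  | repl => exact repl (f ())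
  | res => exact res (f ())
  | inp a n => exact inp a n (f ())
  | out a bs => exact out a bs (f ())
  | ite m n =>
    have h : f = fun b => cond b (f true) (f false) := funext fun b => by cases b <;> rfl
    rw [h]; exact ite _ _ _ _

variable (σ : ℕ → Nm N)

@[simp] theorem subst_nil : (nil : Proc N).subst σ = nil := by
  unfold subst
  rw [PFunctor.M.corec_def]
  unfold nil
  congr 1
  exact Sigma.ext rfl (heq_of_eq (funext fun i => i.elim))

@[simp] theorem subst_par (P Q : Proc N) : (P.par Q).subst σ = (P.subst σ).par (Q.subst σ) := by
  conv_lhs => unfold subst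
  rw [PFunctor.M.corec_def]
  unfold par
  congr 1
  exact Sigma.ext rfl (heq_of_eq (funext fun i => by cases i <;> rfl))

@[simp] theorem subst_repl (P : Proc N) : P.repl.subst σ = (P.subst σ).repl := by
  conv_lhs => unfold subst
  rw [PFunctor.M.corec_def]
  rfl

@[simp] theorem subst_res (P : Proc N) : P.res.subst σ = (P.subst (Nm.lift 1 σ)).res := by
  conv_lhs => unfold subst
  rw [PFunctor.M.corec_def]
  rfl

@[simp] theorem subst_inp (a : Nm N) (n : ℕ) (P : Proc N) :
    (inp a n P).subst σ = inp (a.subst σ) n (P.subst (Nm.lift n σ)) := by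
  conv_lhs => unfold subst
  rw [PFunctor.M.corec_def]
  rfl

@[simp] theorem subst_out (a : Nm N) (bs : List (Nm N)) (P : Proc N) :
    (out a bs P).subst σ = out (a.subst σ) (bs.map (Nm.subst σ)) (P.subst σ) := by
  conv_lhs => unfold subst
  rw [PFunctor.M.corec_def]
  rfl

@[simp] theorem subst_ite (m n : Nm N) (P Q : Proc N) :
    (ite m n P Q).subst σ = ite (m.subst σ) (n.subst σ) (P.subst σ) (Q.subst σ) := by
  conv_lhs => unfold subst
  rw [PFunctor.M.corec_def]
  unfold ite
  congr 1
  exact Sigma.ext rfl (heq_of_eq (funext fun i => by cases i <;> rfl))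

/-- One step of a bisimulation: the two processes carry the same root, and `R` relates their
immediate subterms. -/
inductive SameRoot (R : Proc N → Proc N → Prop) : Proc N → Proc N → Prop
  | nil : SameRoot R nil nil
  | par {A B A' B'} : R A A' → R B B' → SameRoot R (par A B) (par A' B')
  | repl {A A'} : R A A' → SameRoot R (repl A) (repl A')
  | res {A A'} : R A A' → SameRoot R (res A) (res A')
  | inp (a n) {A A'} : R A A' → SameRoot R (inp a n A) (inp a n A')
  | out (a bs) {A A'} : R A A' → SameRoot R (out a bs A) (out a bs A')
  | ite (m n) {A B A' B'} : R A A' → R B B' → SameRoot R (ite m n A B) (ite m n A' B')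

/-- Bisimilar syntax trees are equal. -/
theorem eq_of_sameRoot (R : Proc N → Proc N → Prop) (h : ∀ P Q, R P Q → SameRoot R P Q)
    {P Q : Proc N} (hPQ : R P Q) : P = Q := by
  refine PFunctor.M.bisim (P := sig N) R (fun P Q hR => ?_) P Q hPQ
  cases h P Q hR with
  | nil => exact ⟨_, _, _, rfl, rfl, fun i => i.elim⟩
  | par h₁ h₂ => exact ⟨_, _, _, rfl, rfl, fun i => by cases i; exacts [h₂, h₁]⟩
  | repl h => exact ⟨_, _, _, rfl, rfl, fun _ => h⟩
  | res h => exact ⟨_, _, _, rfl, rfl, fun _ => h⟩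
  | inp a n h => exact ⟨_, _, _, rfl, rfl, fun _ => h⟩
  | out a bs h => exact ⟨_, _, _, rfl, rfl, fun _ => h⟩
  | ite m n h₁ h₂ => exact ⟨_, _, _, rfl, rfl, fun i => by cases i; exacts [h₂, h₁]⟩

@[simp] theorem subst_id (P : Proc N) : P.subst Nm.bound = P := by
  refine eq_of_sameRoot (fun A B => A = B.subst Nm.bound) ?_ rfl
  rintro _ P rfl
  have h : Nm.subst Nm.bound = (id : Nm N → Nm N) := funext Nm.subst_id
  cases P using cases_on_node with
  | nil => rw [subst_nil]; exact .nil
  | par => rw [subst_par]; exact .par rfl rfl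
  | repl => rw [subst_repl]; exact .repl rfl
  | res => rw [subst_res, Nm.lift_bound]; exact .res rfl
  | inp => rw [subst_inp, Nm.lift_bound, Nm.subst_id]; exact .inp _ _ rfl
  | out => rw [subst_out, h, List.map_id]; exact .out _ _ rfl
  | ite => rw [subst_ite, Nm.subst_id, Nm.subst_id]; exact .ite _ _ rfl rfl

theorem subst_subst (σ τ : ℕ → Nm N) (P : Proc N) :
    (P.subst σ).subst τ = P.subst fun k => (σ k).subst τ := by
  refine eq_of_sameRoot (fun A B => ∃ (P : Proc N) (σ τ : ℕ → Nm N),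
    A = (P.subst σ).subst τ ∧ B = P.subst fun k => (σ k).subst τ) ?_ ⟨P, σ, τ, rfl, rfl⟩
  rintro _ _ ⟨P, σ, τ, rfl, rfl⟩
  cases P using cases_on_node with
  | nil => simp only [subst_nil]; exact .nil
  | par => simp only [subst_par]; exact .par ⟨_, _, _, rfl, rfl⟩ ⟨_, _, _, rfl, rfl⟩
  | repl => simp only [subst_repl]; exact .repl ⟨_, _, _, rfl, rfl⟩
  | res => simp only [subst_res, ← Nm.lift_comp]; exact .res ⟨_, _, _, rfl, rfl⟩
  | inp =>
    simp only [subst_inp, Nm.subst_subst, ← Nm.lift_comp]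
    exact .inp _ _ ⟨_, _, _, rfl, rfl⟩
  | out =>
    have h : Nm.subst τ ∘ Nm.subst σ = Nm.subst fun k => (σ k).subst τ :=
      funext fun m => Nm.subst_subst σ τ m
    simp only [subst_out, Nm.subst_subst, List.map_map, h]
    exact .out _ _ ⟨_, _, _, rfl, rfl⟩
  | ite =>
    simp only [subst_ite, Nm.subst_subst]
    exact .ite _ _ ⟨_, _, _, rfl, rfl⟩ ⟨_, _, _, rfl, rfl⟩

theorem weaken_subst_lift (σ : ℕ → Nm N) (P : Proc N) :
    P.weaken.subst (Nm.lift 1 σ) = (P.subst σ).weaken := by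
  simp [weaken, subst_subst, Nm.shift_eq_subst]

theorem swap_subst_lift (σ : ℕ → Nm N) (P : Proc N) :
    (P.subst Nm.swap).subst (Nm.lift 1 (Nm.lift 1 σ)) =
      (P.subst (Nm.lift 1 (Nm.lift 1 σ))).subst Nm.swap := by
  rw [subst_subst, subst_subst]
  congr 1
  funext k
  match k with
  | 0 => rfl
  | 1 => rfl
  | k + 2 =>
    simp only [Nm.swap, Nm.subst_bound, Nm.lift_one_succ, Nm.shift_eq_subst, Nm.subst_subst]

end Proc

/-- The only name of a chain that a substitution can reach is its entry channel. -/
@[simp] theorem subst_chain {N : Type w} (σ : ℕ → Nm N) (c : Nm N) (s : Stream' N) :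
    (chain c s).subst σ = chain (c.subst σ) s := by
  let T (c : Nm N) (s : Stream' N) : Proc N :=
    (Proc.out c [Nm.free s.head, Nm.bound 0] Proc.nil).par (chain (Nm.bound 0) s.tail)
  refine Proc.eq_of_sameRoot (fun A B => A = B ∨
    (∃ (σ : ℕ → Nm N) (c : Nm N) (s : Stream' N),
      A = (chain c s).subst σ ∧ B = chain (c.subst σ) s) ∨
    ∃ (σ : ℕ → Nm N) (c : Nm N) (s : Stream' N),
      A = (T (c.shift 1) s).subst (Nm.lift 1 σ) ∧ B = T ((c.subst σ).shift 1) s) ?_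
    (.inr (.inl ⟨σ, c, s, rfl, rfl⟩))
  rintro A B (rfl | ⟨σ, c, s, rfl, rfl⟩ | ⟨σ, c, s, rfl, rfl⟩)
  · cases A using Proc.cases_on_node <;> constructor <;> exact .inl rfl
  · rw [chain_unfold c s, chain_unfold _ s, Proc.subst_res]
    exact .res (.inr (.inr ⟨σ, c, s, rfl, rfl⟩))
  · simp only [T, Proc.subst_par]
    refine .par (.inl ?_) (.inr (.inl ⟨_, _, _, rfl, rfl⟩))
    simp [Nm.shift_subst_lift]

/-! ### Instantiation of input-bound names -/

namespace Nm

variable {N : Type w}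

/-- The substitution that replaces the `bs.length` innermost indices by `bs` and applies `θ` to the
remaining ones. -/
def cons (bs : List (Nm N)) (θ : ℕ → Nm N) : ℕ → Nm N :=
  fun k => bs.getD k (θ (k - bs.length))

theorem cons_subst (bs : List (Nm N)) (θ τ : ℕ → Nm N) (k : ℕ) :
    (cons bs θ k).subst τ = cons (bs.map (subst τ)) (fun k => (θ k).subst τ) k := by
  simp only [cons, List.getD_eq_getElem?_getD, List.getElem?_map, List.length_map]
  cases bs[k]? <;> rfl

theorem lift_subst_cons (bs : List (Nm N)) (θ τ : ℕ → Nm N) (k : ℕ) :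
    (lift bs.length θ k).subst (cons bs τ) = cons bs (fun k => (θ k).subst τ) k := by
  by_cases h : k < bs.length
  · simp [lift, h, cons]
  · have : (fun j => cons bs τ (j + bs.length)) = τ := by
      funext j
      simp [cons]
    simp only [lift, h, if_false, shift_eq_subst, subst_subst, subst_bound, this]
    simp [cons, h]

/-- The substitution that renames indices along `f`. -/
def ren (f : ℕ → ℕ) : ℕ → Nm N := fun k => bound (f k)

theorem subst_ren_injective {f : ℕ → ℕ} (hf : f.Injective) :
    Function.Injective (subst (ren f : ℕ → Nm N)) := by
  rintro (a | k) (b | l) h <;> simp_all [ren, subst, hf.eq_iff]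

theorem subst_ren_eq_free {f : ℕ → ℕ} {m : Nm N} {a : N} :
    m.subst (ren f) = free a ↔ m = free a := by
  cases m <;> simp [ren]

theorem subst_ren_eq_bound {f : ℕ → ℕ} {m : Nm N} {k : ℕ} :
    m.subst (ren f) = bound k ↔ ∃ j, m = bound j ∧ f j = k := by
  cases m <;> simp [ren]

/-- A renaming of indices transported under one binder. -/
def up (f : ℕ → ℕ) : ℕ → ℕ
  | 0 => 0
  | k + 1 => f k + 1

theorem up_injective {f : ℕ → ℕ} (hf : f.Injective) : (up f).Injective := by
  rintro (_ | k) (_ | l) h <;> simp_all [up, hf.eq_iff]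

theorem lift_one_ren (f : ℕ → ℕ) : lift 1 (ren f : ℕ → Nm N) = ren (up f) := by
  funext k
  cases k <;> simp [ren, up]

end Nm

/-! ### A linear typing of processes -/

variable {S : Type u} {Q : Type v} {N : Type w}

/-- The linear resource of the type system, which records the phase of the simulation: either the
machine is in the configuration `c`, or the tuple `t` has been chosen on the tape `T` and the
neighbouring cell has not been read yet. -/
inductive Token (S : Type u) (Q : Type v) : Type (max u v)
  | head (c : Config S Q)
  | pend (t : Transition S Q) (T : Tape S)

/-- The side of the tape towards which the head moves. -/
def Tape.side (T : Tape S) : Turing.Dir → Stream' S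
  | .left => T.left
  | .right => T.right

/-- The two kinds of inputs: the first prefix of the encoding of the tuple `t`, and its second
prefix, waiting for the content of a neighbouring cell of the tape `T`. -/
inductive Input (S : Type u) (Q : Type v) : Type (max u v)
  | start (t : Transition S Q)
  | read (t : Transition S Q) (T : Tape S)

/-- The contexts of the type system: the index `k` has the type `ρ k`, the stream of symbols stored
in the chain with the entry channel `k`. -/
abbrev Ctx (S : Type u) : Type u := ℕ → Stream' S

/-- The context under one restriction. -/
def Ctx.push (s : Stream' S) (ρ : Ctx S) : Ctx S
  | 0 => s
  | k + 1 => ρ k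

variable (name : S ⊕ Q × S ↪ N) (M : TuringMachine S Q)

/-- The typing rule for an output of `bs` on `a`. Without a token it is a cell of a chain, and with
the token `head c` it is the announcement of the state and the scanned symbol of `c`. -/
def OutTyped (ρ : Ctx S) (a : Nm N) (bs : List (Nm N)) : Option (Token S Q) → Prop
  | none => ∃ i j, a = Nm.bound i ∧ bs = [symName name (ρ i).head, Nm.bound j] ∧
      ρ j = (ρ i).tail
  | some (.head c) => a = chanName name c.state c.tape.head ∧
      ∃ i j, bs = [Nm.bound i, Nm.bound j] ∧ ρ i = c.tape.left ∧ ρ j = c.tape.right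
  | some (.pend _ _) => False

/-- An input on `a` that owns the token `τ` is of the given kind. -/
def InpTyped (ρ : Ctx S) (a : Nm N) (τ : Option (Token S Q)) : Input S Q → Prop
  | .start t => τ = none ∧ t ∈ M.transitions ∧ a = chanName name t.src t.read
  | .read t T => τ = some (.pend t T) ∧ ∃ k, a = Nm.bound k ∧ ρ k = T.side t.dir

/-- An input of the given kind may receive the names `bs`, and it then owns the token `τ`. -/
def Receives (ρ : Ctx S) (bs : List (Nm N)) (τ : Option (Token S Q)) : Input S Q → Prop
  | .start t => ∃ i j, bs = [Nm.bound i, Nm.bound j] ∧ τ = some (.pend t ⟨ρ i, t.read, ρ j⟩)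
  | .read t T => ∃ j, bs = [symName name (T.side t.dir).head, Nm.bound j] ∧
      ρ j = (T.side t.dir).tail ∧ τ = some (.head ⟨T.writeMove t.write t.dir, t.dst⟩)

/-- The renaming `f` is injective and preserves types. -/
structure Ctx.Emb (f : ℕ → ℕ) (ρ ρ' : Ctx S) : Prop where
  inj : f.Injective
  eq : ∀ k, ρ' (f k) = ρ k

/-- One layer of the type system. Parallel composition splits the token, and name comparison is
decided by the identity of the names. A replicated process has to be typed without the token, as
all but one of its copies do not own it. The body of an input has to be typed for all names that it
may receive, in every context that extends the present one: scope extrusion can add names to the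
context before the input is consumed. -/
def typedStep (R : Proc N → Ctx S → Option (Token S Q) → Prop) (P : Proc N) (ρ : Ctx S)
    (τ : Option (Token S Q)) : Prop :=
  match PFunctor.M.dest (F := sig N) P with
  | ⟨.nil, _⟩ => τ = none
  | ⟨.par, f⟩ => (R (f true) ρ τ ∧ R (f false) ρ none) ∨ (R (f true) ρ none ∧ R (f false) ρ τ)
  | ⟨.repl, f⟩ => R (f ()) ρ none ∧ R (f ()) ρ τ
  | ⟨.res, f⟩ => ∃ s, R (f ()) (ρ.push s) τ
  | ⟨.inp a n, f⟩ => n = 2 ∧ ∃ κ, InpTyped name M ρ a τ κ ∧ ∀ g ρ', Ctx.Emb g ρ ρ' →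
      ∀ bs τ', Receives name ρ' bs τ' κ → R (Proc.subst (Nm.cons bs (Nm.ren g)) (f ())) ρ' τ'
  | ⟨.out a bs, f⟩ => OutTyped name ρ a bs τ ∧ R (f ()) ρ none
  | ⟨.ite m n, f⟩ => (m = n → R (f true) ρ τ) ∧ (m ≠ n → R (f false) ρ τ)

/-- The typing judgement: the process `P` respects the protocol of the encoding in the context `ρ`,
and it owns the token `τ`. As processes may be infinite, this is the greatest fixed point of
`typedStep`. -/
def Typed (P : Proc N) (ρ : Ctx S) (τ : Option (Token S Q)) : Prop :=
  ∃ R : Proc N → Ctx S → Option (Token S Q) → Prop,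
    (∀ P ρ τ, R P ρ τ → typedStep name M R P ρ τ) ∧ R P ρ τ

variable {name M}

theorem typedStep_mono {R R' : Proc N → Ctx S → Option (Token S Q) → Prop}
    (h : ∀ P ρ τ, R P ρ τ → R' P ρ τ) {P : Proc N} {ρ : Ctx S} {τ : Option (Token S Q)}
    (hP : typedStep name M R P ρ τ) : typedStep name M R' P ρ τ := by
  unfold typedStep at *
  split at hP
  · exact hP
  · exact hP.imp (And.imp (h _ _ _) (h _ _ _)) (And.imp (h _ _ _) (h _ _ _))
  · exact hP.imp (h _ _ _) (h _ _ _)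
  · exact hP.imp fun _ => h _ _ _
  · obtain ⟨h₁, κ, h₂, h₃⟩ := hP
    exact ⟨h₁, κ, h₂, fun g ρ' hg bs τ' hb => h _ _ _ (h₃ g ρ' hg bs τ' hb)⟩
  · exact hP.imp_right (h _ _ _)
  · exact ⟨fun e => h _ _ _ (hP.1 e), fun e => h _ _ _ (hP.2 e)⟩

theorem Typed.step {P : Proc N} {ρ : Ctx S} {τ : Option (Token S Q)} (h : Typed name M P ρ τ) :
    typedStep name M (Typed name M) P ρ τ :=
  let ⟨R, hR, hP⟩ := h
  typedStep_mono (fun _ _ _ h => ⟨R, hR, h⟩) (hR _ _ _ hP)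

/-- The coinduction principle of the type system. -/
theorem Typed.coind (R : Proc N → Ctx S → Option (Token S Q) → Prop)
    (hR : ∀ P ρ τ, R P ρ τ →
      typedStep name M (fun P ρ τ => R P ρ τ ∨ Typed name M P ρ τ) P ρ τ)
    {P : Proc N} {ρ : Ctx S} {τ : Option (Token S Q)} (h : R P ρ τ) : Typed name M P ρ τ := by
  refine ⟨fun P ρ τ => R P ρ τ ∨ Typed name M P ρ τ, ?_, .inl h⟩
  rintro P ρ τ (h | h)
  · exact hR _ _ _ h
  · exact typedStep_mono (fun _ _ _ => .inr) h.step

theorem typed_iff {P : Proc N} {ρ : Ctx S} {τ : Option (Token S Q)} :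
    Typed name M P ρ τ ↔ typedStep name M (Typed name M) P ρ τ :=
  ⟨Typed.step, fun h => Typed.coind (typedStep name M (Typed name M))
    (fun _ _ _ h => typedStep_mono (fun _ _ _ => .inr) h) h⟩

section Rules

variable {ρ : Ctx S} {τ : Option (Token S Q)}

theorem typed_nil : Typed name M Proc.nil ρ τ ↔ τ = none := typed_iff

theorem typed_par {A B : Proc N} : Typed name M (A.par B) ρ τ ↔
    (Typed name M A ρ τ ∧ Typed name M B ρ none) ∨
      (Typed name M A ρ none ∧ Typed name M B ρ τ) := typed_iff

theorem typed_repl {A : Proc N} :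
    Typed name M A.repl ρ τ ↔ Typed name M A ρ none ∧ Typed name M A ρ τ := typed_iff

theorem typed_res {A : Proc N} :
    Typed name M A.res ρ τ ↔ ∃ s, Typed name M A (ρ.push s) τ := typed_iff

theorem typed_inp {a : Nm N} {n : ℕ} {A : Proc N} : Typed name M (Proc.inp a n A) ρ τ ↔
    n = 2 ∧ ∃ κ, InpTyped name M ρ a τ κ ∧ ∀ g ρ', Ctx.Emb g ρ ρ' →
      ∀ bs τ', Receives name ρ' bs τ' κ →
        Typed name M (A.subst (Nm.cons bs (Nm.ren g))) ρ' τ' := typed_iff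

theorem typed_out {a : Nm N} {bs : List (Nm N)} {A : Proc N} :
    Typed name M (Proc.out a bs A) ρ τ ↔ OutTyped name ρ a bs τ ∧ Typed name M A ρ none :=
  typed_iff

theorem typed_ite {m n : Nm N} {A B : Proc N} : Typed name M (Proc.ite m n A B) ρ τ ↔
    (m = n → Typed name M A ρ τ) ∧ (m ≠ n → Typed name M B ρ τ) := typed_iff

end Rules

/-! ### Invariance of typing under renaming -/

section Renaming

variable {f : ℕ → ℕ} {ρ ρ' : Ctx S} {τ : Option (Token S Q)}

theorem Ctx.Emb.id (ρ : Ctx S) : Ctx.Emb id ρ ρ := ⟨Function.injective_id, fun _ => rfl⟩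

theorem Ctx.Emb.comp {g : ℕ → ℕ} {ρ'' : Ctx S} (hg : Ctx.Emb g ρ' ρ'') (hf : Ctx.Emb f ρ ρ') :
    Ctx.Emb (g ∘ f) ρ ρ'' :=
  ⟨hg.inj.comp hf.inj, fun k => (hg.eq _).trans (hf.eq k)⟩

theorem Ctx.Emb.up (hf : Ctx.Emb f ρ ρ') (s : Stream' S) :
    Ctx.Emb (Nm.up f) (ρ.push s) (ρ'.push s) :=
  ⟨Nm.up_injective hf.inj, fun k => by cases k; exacts [rfl, hf.eq _]⟩

/-- Two extensions of a context have a common extension. -/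
theorem Ctx.Emb.amalgamate {g : ℕ → ℕ} {ρ'' : Ctx S} (hf : Ctx.Emb f ρ ρ')
    (hg : Ctx.Emb g ρ ρ'') : ∃ h k χ, Ctx.Emb h ρ' χ ∧ Ctx.Emb k ρ'' χ ∧ h ∘ f = k ∘ g := by
  classical
  -- The indices of `ρ''` become the even ones, those of `ρ'` outside the image of `f` the odd ones.
  let h : ℕ → ℕ := fun j => if e : ∃ i, f i = j then 2 * g e.choose else 2 * j + 1
  have hh (i : ℕ) : h (f i) = 2 * g i := by
    have e : ∃ j, f j = f i := ⟨i, rfl⟩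
    have : e.choose = i := hf.inj e.choose_spec
    simp only [h, dif_pos e, this]
  refine ⟨h, fun i => 2 * i, fun n => if n % 2 = 0 then ρ'' (n / 2) else ρ' (n / 2),
    ⟨fun a b hab => ?_, fun j => ?_⟩, ⟨fun a b hab => by simpa using hab, fun i => by simp⟩,
    funext fun i => hh i⟩
  · by_cases ha : ∃ i, f i = a <;> by_cases hb : ∃ i, f i = b
    · obtain ⟨i, rfl⟩ := ha
      obtain ⟨j, rfl⟩ := hb
      rw [hh, hh] at hab
      rw [hg.inj (by omega : g i = g j)]
    · simp only [h, dif_pos ha, dif_neg hb] at hab; omega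
    · simp only [h, dif_neg ha, dif_pos hb] at hab; omega
    · simp only [h, dif_neg ha, dif_neg hb] at hab; omega
  · by_cases hj : ∃ i, f i = j
    · obtain ⟨i, rfl⟩ := hj
      rw [hh]
      simp [hf.eq, hg.eq]
    · have h₁ : (2 * j + 1) % 2 ≠ 0 := by omega
      have h₂ : (2 * j + 1) / 2 = j := by omega
      simp only [h, dif_neg hj, if_neg h₁, h₂]

theorem outTyped_ren (hf : Ctx.Emb f ρ ρ') {a : Nm N} {bs : List (Nm N)} :
    OutTyped name ρ' (a.subst (Nm.ren f)) (bs.map (Nm.subst (Nm.ren f))) τ ↔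
      OutTyped name ρ a bs τ := by
  rcases τ with _ | c | _
  · constructor
    · rintro ⟨i, j, ha, hb, hρ⟩
      obtain ⟨i, rfl, rfl⟩ := Nm.subst_ren_eq_bound.1 ha
      obtain ⟨b, l, rfl, h₁, hl⟩ := List.map_eq_cons_iff.1 hb
      obtain ⟨b', l, rfl, h₂, h₃⟩ := List.map_eq_cons_iff.1 hl
      obtain ⟨j, rfl, rfl⟩ := Nm.subst_ren_eq_bound.1 h₂
      rw [hf.eq] at h₁ hρ
      rw [hf.eq] at hρ
      cases List.map_eq_nil_iff.1 h₃
      exact ⟨i, j, rfl, by rw [Nm.subst_ren_eq_free.1 h₁]; rfl, hρ⟩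
    · rintro ⟨i, j, rfl, rfl, hρ⟩
      exact ⟨f i, f j, rfl, by rw [hf.eq]; rfl, by rw [hf.eq, hf.eq, hρ]⟩
  · constructor
    · rintro ⟨ha, i, j, hb, hi, hj⟩
      obtain ⟨b, l, rfl, h₁, hl⟩ := List.map_eq_cons_iff.1 hb
      obtain ⟨b', l, rfl, h₂, h₃⟩ := List.map_eq_cons_iff.1 hl
      obtain ⟨i, rfl, rfl⟩ := Nm.subst_ren_eq_bound.1 h₁
      obtain ⟨j, rfl, rfl⟩ := Nm.subst_ren_eq_bound.1 h₂
      rw [hf.eq] at hi hj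
      cases List.map_eq_nil_iff.1 h₃
      exact ⟨Nm.subst_ren_eq_free.1 ha, i, j, rfl, hi, hj⟩
    · rintro ⟨rfl, i, j, rfl, hi, hj⟩
      exact ⟨rfl, f i, f j, rfl, by rw [hf.eq, hi], by rw [hf.eq, hj]⟩
  · exact Iff.rfl

theorem inpTyped_ren (hf : Ctx.Emb f ρ ρ') {a : Nm N} {κ : Input S Q} :
    InpTyped name M ρ' (a.subst (Nm.ren f)) τ κ ↔ InpTyped name M ρ a τ κ := by
  cases κ with
  | start t => exact and_congr_right' (and_congr_right' Nm.subst_ren_eq_free)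
  | read t T =>
    refine and_congr_right' ⟨?_, ?_⟩
    · rintro ⟨k, ha, hk⟩
      obtain ⟨k, rfl, rfl⟩ := Nm.subst_ren_eq_bound.1 ha
      exact ⟨k, rfl, by rw [← hf.eq, hk]⟩
    · rintro ⟨k, rfl, hk⟩
      exact ⟨f k, rfl, by rw [hf.eq, hk]⟩

theorem Receives.ren (hf : Ctx.Emb f ρ ρ') {bs : List (Nm N)} {κ : Input S Q}
    (h : Receives name ρ bs τ κ) : Receives name ρ' (bs.map (Nm.subst (Nm.ren f))) τ κ := by
  cases κ with
  | start t =>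
    obtain ⟨i, j, rfl, rfl⟩ := h
    exact ⟨f i, f j, rfl, by rw [hf.eq, hf.eq]⟩
  | read t T =>
    obtain ⟨j, rfl, hj, rfl⟩ := h
    exact ⟨f j, rfl, by rw [hf.eq, hj], rfl⟩

theorem Receives.length_eq {bs : List (Nm N)} {κ : Input S Q} (h : Receives name ρ bs τ κ) :
    bs.length = 2 := by
  cases κ with
  | start t => obtain ⟨i, j, rfl, rfl⟩ := h; rfl
  | read t T => obtain ⟨j, rfl, -⟩ := h; rfl

theorem Proc.subst_lift_cons {bs : List (Nm N)} {n : ℕ} (hn : bs.length = n) (θ η : ℕ → Nm N)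
    (A : Proc N) : (A.subst (Nm.lift n θ)).subst (Nm.cons bs η) =
      A.subst (Nm.cons bs fun k => (θ k).subst η) := by
  subst hn
  rw [Proc.subst_subst]
  congr 1
  exact funext fun k => Nm.lift_subst_cons bs θ η k

theorem Proc.subst_cons_subst (bs : List (Nm N)) (θ η : ℕ → Nm N) (A : Proc N) :
    (A.subst (Nm.cons bs θ)).subst η =
      A.subst (Nm.cons (bs.map (Nm.subst η)) fun k => (θ k).subst η) := by
  rw [Proc.subst_subst]
  congr 1
  exact funext fun k => Nm.cons_subst bs θ η k

/-- Weakening: typing is preserved when the context is extended. -/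
theorem Typed.ren {P : Proc N} (hf : Ctx.Emb f ρ ρ') (hP : Typed name M P ρ τ) :
    Typed name M (P.subst (Nm.ren f)) ρ' τ := by
  refine Typed.coind (fun P' ρ' τ => ∃ P f ρ, P' = P.subst (Nm.ren f) ∧ Ctx.Emb f ρ ρ' ∧
    Typed name M P ρ τ) ?_ ⟨P, f, ρ, rfl, hf, hP⟩
  rintro _ ρ' τ ⟨P, f, ρ, rfl, hf, hP⟩
  cases P using Proc.cases_on_node with
  | nil => rw [Proc.subst_nil]; exact typed_nil.1 hP
  | par A B =>
    rw [Proc.subst_par]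
    exact (typed_par.1 hP).imp
      (And.imp (fun h => .inl ⟨_, _, _, rfl, hf, h⟩) (fun h => .inl ⟨_, _, _, rfl, hf, h⟩))
      (And.imp (fun h => .inl ⟨_, _, _, rfl, hf, h⟩) (fun h => .inl ⟨_, _, _, rfl, hf, h⟩))
  | repl A =>
    rw [Proc.subst_repl]
    exact (typed_repl.1 hP).imp (fun h => .inl ⟨_, _, _, rfl, hf, h⟩)
      (fun h => .inl ⟨_, _, _, rfl, hf, h⟩)
  | res A =>
    rw [Proc.subst_res, Nm.lift_one_ren]
    exact (typed_res.1 hP).imp fun s h => .inl ⟨_, _, _, rfl, hf.up s, h⟩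
  | inp a n A =>
    rw [Proc.subst_inp]
    obtain ⟨hn, κ, ha, h⟩ := typed_inp.1 hP
    refine ⟨hn, κ, (inpTyped_ren hf).2 ha, fun g ρ'' hg bs τ' hb => .inr ?_⟩
    have := h (g ∘ f) ρ'' (hg.comp hf) bs τ' hb
    change Typed name M ((A.subst _).subst _) _ _
    rwa [Proc.subst_lift_cons (hb.length_eq.trans hn.symm)]
  | out a bs A =>
    rw [Proc.subst_out]
    exact (typed_out.1 hP).imp (outTyped_ren hf).2 fun h => .inl ⟨_, _, _, rfl, hf, h⟩
  | ite m n A B =>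
    rw [Proc.subst_ite]
    obtain ⟨h₁, h₂⟩ := typed_ite.1 hP
    exact ⟨fun e => .inl ⟨_, _, _, rfl, hf, h₁ (Nm.subst_ren_injective hf.inj e)⟩,
      fun e => .inl ⟨_, _, _, rfl, hf, h₂ fun e' => e (e' ▸ rfl)⟩⟩

/-- Strengthening: names that do not occur may be removed from the context. For an input, the
extension of the small context in which the input is received is amalgamated with the large one. -/
theorem Typed.of_ren {P : Proc N} (hf : Ctx.Emb f ρ ρ')
    (hP : Typed name M (P.subst (Nm.ren f)) ρ' τ) : Typed name M P ρ τ := by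
  refine Typed.coind (fun P ρ τ => ∃ f ρ', Ctx.Emb f ρ ρ' ∧
    Typed name M (P.subst (Nm.ren f)) ρ' τ) ?_ ⟨f, ρ', hf, hP⟩
  rintro P ρ τ ⟨f, ρ', hf, hP⟩
  cases P using Proc.cases_on_node with
  | nil => rw [Proc.subst_nil] at hP; exact typed_nil.1 hP
  | par A B =>
    rw [Proc.subst_par] at hP
    exact (typed_par.1 hP).imp
      (And.imp (fun h => .inl ⟨_, _, hf, h⟩) (fun h => .inl ⟨_, _, hf, h⟩))
      (And.imp (fun h => .inl ⟨_, _, hf, h⟩) (fun h => .inl ⟨_, _, hf, h⟩))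
  | repl A =>
    rw [Proc.subst_repl] at hP
    exact (typed_repl.1 hP).imp (fun h => .inl ⟨_, _, hf, h⟩) (fun h => .inl ⟨_, _, hf, h⟩)
  | res A =>
    rw [Proc.subst_res, Nm.lift_one_ren] at hP
    exact (typed_res.1 hP).imp fun s h => .inl ⟨_, _, hf.up s, h⟩
  | inp a n A =>
    rw [Proc.subst_inp] at hP
    obtain ⟨hn, κ, ha, h⟩ := typed_inp.1 hP
    refine ⟨hn, κ, (inpTyped_ren hf).1 ha, fun g ρ'' hg bs τ' hb => .inl ?_⟩
    obtain ⟨i, j, χ, hi, hj, hij⟩ := hf.amalgamate hg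
    have := h i χ hi _ τ' (hb.ren hj)
    rw [Proc.subst_lift_cons (by rw [List.length_map, hb.length_eq, hn])] at this
    refine ⟨j, χ, hj, ?_⟩
    change Typed name M ((A.subst _).subst _) _ _
    rw [Proc.subst_cons_subst]
    have e : (fun k => (Nm.ren g k : Nm N).subst (Nm.ren j)) =
        fun k => (Nm.ren f k).subst (Nm.ren i) :=
      funext fun k => congrArg Nm.bound (congrFun hij k).symm
    rwa [e]
  | out a bs A =>
    rw [Proc.subst_out] at hP
    exact (typed_out.1 hP).imp (outTyped_ren hf).1 fun h => .inl ⟨_, _, hf, h⟩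
  | ite m n A B =>
    rw [Proc.subst_ite] at hP
    obtain ⟨h₁, h₂⟩ := typed_ite.1 hP
    exact ⟨fun e => .inl ⟨_, _, hf, h₁ (e ▸ rfl)⟩,
      fun e => .inl ⟨_, _, hf, h₂ fun e' => e (Nm.subst_ren_injective hf.inj e')⟩⟩

theorem typed_ren_iff {P : Proc N} (hf : Ctx.Emb f ρ ρ') :
    Typed name M (P.subst (Nm.ren f)) ρ' τ ↔ Typed name M P ρ τ :=
  ⟨Typed.of_ren hf, Typed.ren hf⟩

theorem typed_weaken_iff {P : Proc N} (s : Stream' S) :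
    Typed name M P.weaken (ρ.push s) τ ↔ Typed name M P ρ τ :=
  typed_ren_iff (f := fun k => k + 1) ⟨add_left_injective 1, fun _ => rfl⟩

theorem typed_swap_iff {P : Proc N} (s s' : Stream' S) :
    Typed name M (P.subst Nm.swap) ((ρ.push s').push s) τ ↔
      Typed name M P ((ρ.push s).push s') τ := by
  let f : ℕ → ℕ := fun | 0 => 1 | 1 => 0 | k + 2 => k + 2
  have hf : (Nm.swap : ℕ → Nm N) = Nm.ren f := funext fun | 0 => rfl | 1 => rfl | _ + 2 => rfl
  rw [hf]
  refine typed_ren_iff ⟨?_, fun | 0 => rfl | 1 => rfl | _ + 2 => rfl⟩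
  have : Function.Involutive f := fun | 0 => rfl | 1 => rfl | _ + 2 => rfl
  exact this.injective

end Renaming

/-! ### Invariance of typing under structural congruence -/

/-- The substitution `θ` keeps distinct names distinct, except for the input-bound ones in `V`. -/
def Nm.InjOff (V : Set ℕ) (θ : ℕ → Nm N) : Prop :=
  ∀ m n : Nm N, m.NotIn V → n.NotIn V → m.subst θ = n.subst θ → m = n

theorem Nm.InjOff.lift_one {V : Set ℕ} {θ : ℕ → Nm N} (h : Nm.InjOff V θ) :
    Nm.InjOff (underRes V) (Nm.lift 1 θ) := by
  have key (x y : Nm N) : x.shift 1 = y.shift 1 → x = y := by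
    cases x <;> cases y <;> simp
  have hne (x : Nm N) : x.shift 1 ≠ Nm.bound 0 := by cases x <;> simp
  have hV (k : ℕ) : (Nm.bound (k + 1) : Nm N).NotIn (underRes V) → (Nm.bound k : Nm N).NotIn V := by
    simp [Nm.NotIn, underRes]
  rintro (a | _ | k) (b | _ | l) hm hn e
  · exact e
  · simp at e
  · have := h (.free a) (.bound l) trivial (hV l hn) (key _ _ (by simpa using e))
    simp at this
  · simp at e
  · rfl
  · exact absurd (by simpa using e.symm) (hne (θ l))
  · have := h (.bound k) (.free b) (hV k hm) trivial (key _ _ (by simpa using e))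
    simp at this
  · exact absurd (by simpa using e) (hne (θ k))
  · have := h (.bound k) (.bound l) (hV k hm) (hV l hn) (key _ _ (by simpa using e))
    simpa using this

theorem Nm.InjOff.cons {V : Set ℕ} {θ : ℕ → Nm N} (h : Nm.InjOff V θ) {g : ℕ → ℕ}
    (hg : g.Injective) (bs : List (Nm N)) :
    Nm.InjOff (underInp bs.length V) (Nm.cons bs fun k => (θ k).subst (Nm.ren g)) := by
  -- Off the received names, the substitution is `θ` after the removal of the innermost binders.
  have key (m : Nm N) (hm : m.NotIn (underInp bs.length V)) : ∃ m' : Nm N, m'.NotIn V ∧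
      m = m'.shift bs.length ∧
      m.subst (Nm.cons bs fun k => (θ k).subst (Nm.ren g)) = (m'.subst θ).subst (Nm.ren g) := by
    cases m with
    | free a => exact ⟨.free a, trivial, rfl, rfl⟩
    | bound k =>
      simp only [Nm.NotIn, underInp, Set.mem_ofPred_eq, not_or, not_lt] at hm
      refine ⟨.bound (k - bs.length), hm.2, ?_, ?_⟩
      · simp [hm.1]
      · simp [Nm.cons, hm.1]
  intro m n hm hn e
  obtain ⟨m', hm', rfl, em⟩ := key m hm
  obtain ⟨n', hn', rfl, en⟩ := key n hn
  rw [em, en] at e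
  rw [h m' n' hm' hn' (Nm.subst_ren_injective hg e)]

/-- Congruent processes have the same types under every substitution that keeps distinct names
distinct, where the input-bound names may be identified with any names. -/
theorem CongUnder.typed_iff {V : Set ℕ} {P P' : Proc N} (h : CongUnder V P P') :
    ∀ (θ : ℕ → Nm N), Nm.InjOff V θ → ∀ (ρ : Ctx S) (τ : Option (Token S Q)),
      Typed name M (P.subst θ) ρ τ ↔ Typed name M (P'.subst θ) ρ τ := by
  induction h with
  | refl => intros; rfl
  | symm _ ih => exact fun θ hθ ρ τ => (ih θ hθ ρ τ).symm
  | trans _ _ ih₁ ih₂ => exact fun θ hθ ρ τ => (ih₁ θ hθ ρ τ).trans (ih₂ θ hθ ρ τ)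
  | par_congr R _ ih => intro θ hθ ρ τ; simp only [Proc.subst_par, typed_par, ih θ hθ]
  | repl_congr _ ih => intro θ hθ ρ τ; simp only [Proc.subst_repl, typed_repl, ih θ hθ]
  | res_congr _ ih =>
    intro θ hθ ρ τ
    simp only [Proc.subst_res, typed_res, ih _ hθ.lift_one]
  | inp_congr a n _ ih =>
    intro θ hθ ρ τ
    simp only [Proc.subst_inp, typed_inp]
    refine and_congr_right fun hn => exists_congr fun κ => and_congr_right' ?_
    refine forall₃_congr fun g ρ' hg => forall₃_congr fun bs τ' hb => ?_
    have hl := hb.length_eq.trans hn.symm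
    rw [Proc.subst_lift_cons hl, Proc.subst_lift_cons hl]
    exact ih _ (hl ▸ hθ.cons hg.inj bs) ρ' τ'
  | out_congr a bs _ ih => intro θ hθ ρ τ; simp only [Proc.subst_out, typed_out, ih θ hθ]
  | ite_congr m n _ _ ih₁ ih₂ =>
    intro θ hθ ρ τ; simp only [Proc.subst_ite, typed_ite, ih₁ θ hθ, ih₂ θ hθ]
  | par_nil V P =>
    intro θ _ ρ τ
    simp only [Proc.subst_par, Proc.subst_nil, typed_par, typed_nil, and_true]
    exact ⟨fun h => h.elim id fun h => h.2 ▸ h.1, .inl⟩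
  | par_comm V P R => intro θ _ ρ τ; simp only [Proc.subst_par, typed_par]; tauto
  | par_assoc V P R T => intro θ _ ρ τ; simp only [Proc.subst_par, typed_par]; tauto
  | res_nil V =>
    intro θ _ ρ τ
    simp only [Proc.subst_res, Proc.subst_nil, typed_res, typed_nil]
    exact ⟨fun ⟨_, h⟩ => h, fun h => ⟨ρ 0, h⟩⟩
  | res_comm V P =>
    intro θ _ ρ τ
    simp only [Proc.subst_res, typed_res, Proc.swap_subst_lift]
    constructor
    · rintro ⟨s, s', h⟩
      exact ⟨s', s, (typed_swap_iff s s').2 h⟩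
    · rintro ⟨s, s', h⟩
      exact ⟨s', s, (typed_swap_iff s' s).1 h⟩
  | scope V P R =>
    intro θ _ ρ τ
    simp only [Proc.subst_par, Proc.subst_res, typed_par, typed_res, Proc.weaken_subst_lift,
      typed_weaken_iff]
    constructor
    · rintro (⟨h, s, h'⟩ | ⟨h, s, h'⟩)
      exacts [⟨s, .inl ⟨h, h'⟩⟩, ⟨s, .inr ⟨h, h'⟩⟩]
    · rintro ⟨s, ⟨h, h'⟩ | ⟨h, h'⟩⟩
      exacts [.inl ⟨h, s, h'⟩, .inr ⟨h, s, h'⟩]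
  | unfold V P =>
    intro θ _ ρ τ
    simp only [Proc.subst_par, Proc.subst_repl, typed_par, typed_repl]
    tauto
  | ite_eq V m P R => intro θ _ ρ τ; simp [typed_ite]
  | ite_ne P R hmn hm hn =>
    intro θ hθ ρ τ
    have : Nm.subst θ _ ≠ Nm.subst θ _ := fun e => hmn (hθ _ _ hm hn e)
    simp [typed_ite, this]

theorem StructCong.typed_iff {P P' : Proc N} (h : StructCong P P') {ρ : Ctx S}
    {τ : Option (Token S Q)} : Typed name M P ρ τ ↔ Typed name M P' ρ τ := by
  simpa using CongUnder.typed_iff h Nm.bound (fun m n _ _ e => by simpa using e) ρ τ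

/-! ### Subject reduction -/

variable (M) in
/-- The effect of a reduction on the token: one transition of the machine takes two of them. -/
inductive TokenStep : Option (Token S Q) → Option (Token S Q) → Prop
  | choose {t : Transition S Q} {c : Config S Q} : t ∈ M.transitions → t.src = c.state →
      t.read = c.tape.head → TokenStep (some (.head c)) (some (.pend t c.tape))
  | read (t : Transition S Q) (T : Tape S) :
      TokenStep (some (.pend t T)) (some (.head ⟨T.writeMove t.write t.dir, t.dst⟩))

/-- Reductions of a typed process follow the machine. In particular a process without the token
does not reduce, and hence all redexes are those of the simulation. -/
theorem Red.typed {P P' : Proc N} (h : Red P P') : ∀ {ρ : Ctx S} {τ : Option (Token S Q)},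
    Typed name M P ρ τ → ∃ τ', TokenStep M τ τ' ∧ Typed name M P' ρ τ' := by
  induction h with
  | comm m bs A B =>
    intro ρ τ h
    rcases typed_par.1 h with ⟨ho, hi⟩ | ⟨ho, hi⟩
    all_goals
      obtain ⟨hout, hA⟩ := typed_out.1 ho
      obtain ⟨-, κ, hκ, hB⟩ := typed_inp.1 hi
      have hB := hB id ρ (.id ρ) bs
    -- The token is with the output: an announcement meets the first prefix of a tuple.
    · rcases κ with t | ⟨t, T⟩
      · obtain ⟨-, ht, rfl⟩ := hκ
        rcases τ with _ | c | _
        · obtain ⟨i, j, hm, -⟩ := hout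
          cases hm
        · obtain ⟨hm, i, j, rfl, hi, hj⟩ := hout
          have hq : t.src = c.state ∧ t.read = c.tape.head := by
            simpa [chanName] using hm
          have := hB _ ⟨i, j, rfl, rfl⟩
          rw [hi, hj, hq.2] at this
          exact ⟨_, .choose ht hq.1 hq.2, typed_par.2 (.inr ⟨hA, this⟩)⟩
        · exact hout.elim
      · exact absurd hκ.1 (by simp)
    -- The token is with the input: the second prefix of a tuple meets a cell of a chain.
    · rcases κ with t | ⟨t, T⟩
      · obtain ⟨-, ht, rfl⟩ := hκ
        obtain ⟨i, j, hm, -⟩ := hout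
        cases hm
      · obtain ⟨rfl, k, rfl, hk⟩ := hκ
        obtain ⟨i, j, hm, rfl, hj⟩ := hout
        cases hm
        have := hB _ ⟨j, by rw [hk], by rw [hj, hk], rfl⟩
        exact ⟨_, .read t T, typed_par.2 (.inr ⟨hA, this⟩)⟩
  | par R _ ih =>
    intro ρ τ h
    rcases typed_par.1 h with ⟨h, hR⟩ | ⟨h, hR⟩
    · obtain ⟨τ', hτ, h'⟩ := ih h
      exact ⟨τ', hτ, typed_par.2 (.inl ⟨h', hR⟩)⟩
    · obtain ⟨τ', hτ, -⟩ := ih h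
      cases hτ
  | res _ ih =>
    intro ρ τ h
    obtain ⟨s, h⟩ := typed_res.1 h
    obtain ⟨τ', hτ, h'⟩ := ih h
    exact ⟨τ', hτ, typed_res.2 ⟨s, h'⟩⟩
  | struct h₁ _ h₂ ih =>
    intro ρ τ h
    obtain ⟨τ', hτ, h'⟩ := ih (h₁.typed_iff.1 h)
    exact ⟨τ', hτ, h₂.typed_iff.1 h'⟩

/-! ### Typing of the encoding -/

section TypedEncoding

variable {S : Type u} {Q : Type v} {N : Type w} {name : S ⊕ Q × S ↪ N} {M : TuringMachine S Q}
  {ρ : Ctx S}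

theorem typed_chain (i : ℕ) :
    Typed name M (chain (Nm.bound i) ((ρ i).map fun s => name (Sum.inl s))) ρ none := by
  -- The second disjunct describes the body of the restriction at the root of a chain.
  refine Typed.coind (fun P ρ τ => τ = none ∧
    ((∃ i, P = chain (Nm.bound i) ((ρ i).map fun s => name (Sum.inl s))) ∨
      ∃ i j, ρ j = (ρ i).tail ∧
        P = (Proc.out (Nm.bound i) [symName name (ρ i).head, Nm.bound j] Proc.nil).par
          (chain (Nm.bound j) ((ρ j).map fun s => name (Sum.inl s))))) ?_ ⟨rfl, .inl ⟨i, rfl⟩⟩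
  rintro P ρ τ ⟨rfl, ⟨i, rfl⟩ | ⟨i, j, hj, rfl⟩⟩
  · rw [chain_unfold]
    exact ⟨(ρ i).tail, .inl ⟨rfl, .inr ⟨i + 1, 0, rfl, rfl⟩⟩⟩
  · exact .inl ⟨.inr (typed_out.2 ⟨⟨i, j, rfl, rfl, hj⟩, typed_nil.2 rfl⟩),
      .inl ⟨rfl, .inl ⟨j, rfl⟩⟩⟩

/-- The type of the entry channel of a chain determines the content of the chain. -/
theorem eq_of_typed_chain {i : ℕ} {s : Stream' S}
    (h : Typed name M (chain (Nm.bound i) (s.map fun s => name (Sum.inl s))) ρ none) :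
    s = ρ i := by
  have step {i : ℕ} {ρ : Ctx S} {s : Stream' S}
      (h : Typed name M (chain (Nm.bound i) (s.map fun s => name (Sum.inl s))) ρ none) :
      s.head = (ρ i).head ∧ ∃ ρ' : Ctx S, ρ' 0 = (ρ i).tail ∧
        Typed name M (chain (Nm.bound 0) (s.tail.map fun s => name (Sum.inl s))) ρ' none := by
    rw [chain_unfold] at h
    obtain ⟨t, h⟩ := typed_res.1 h
    obtain ⟨ho, hc⟩ := (typed_par.1 h).elim id id
    obtain ⟨⟨i', j, hi, hb, ht⟩, -⟩ := typed_out.1 ho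
    simp only [Nm.shift_bound, Nm.bound.injEq] at hi
    subst hi
    simp only [symName, List.cons.injEq, Nm.free.injEq, Nm.bound.injEq, and_true,
      Stream'.head_map, EmbeddingLike.apply_eq_iff_eq, Sum.inl.injEq] at hb
    obtain ⟨hb, rfl⟩ := hb
    exact ⟨hb, _, ht, hc⟩
  refine Stream'.ext fun n => ?_
  induction n generalizing i s ρ with
  | zero => exact (step h).1
  | succ n ih =>
    obtain ⟨-, ρ', h₀, h'⟩ := step h
    exact (ih h').trans (by rw [h₀]; rfl)

theorem dispatch_subst (q : Q) (x l r : Nm N) (ss : List S) (σ : ℕ → Nm N) :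
    (dispatch name q x l r ss).subst σ =
      dispatch name q (x.subst σ) (l.subst σ) (r.subst σ) ss := by
  induction ss with
  | nil => exact Proc.subst_nil σ
  | cons s ss ih =>
    change (Proc.ite _ _ _ (dispatch name q x l r ss)).subst σ = _
    rw [Proc.subst_ite, ih]
    simp [dispatch, symName, chanName]

theorem typed_dispatch {c : Config S Q} {i j : ℕ} (hi : ρ i = c.tape.left)
    (hj : ρ j = c.tape.right) {ss : List S} (hs : c.tape.head ∈ ss) :
    Typed name M (dispatch name c.state (symName name c.tape.head) (Nm.bound i) (Nm.bound j) ss) ρ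
      (some (.head c)) := by
  induction ss with
  | nil => cases hs
  | cons s ss ih =>
    refine typed_ite.2 ⟨fun e => ?_, fun e => ?_⟩
    · have e : c.tape.head = s := by simpa [symName] using e
      exact typed_out.2 ⟨⟨by rw [e], i, j, rfl, hi, hj⟩, typed_nil.2 rfl⟩
    · refine ih ((List.mem_cons.1 hs).resolve_left fun e' => e (by rw [e']))

variable [Fintype S]

theorem typed_encodeTransition {t : Transition S Q} (ht : t ∈ M.transitions) :
    Typed name M (encodeTransition name t) ρ none := by
  refine typed_inp.2 ⟨rfl, .start t, ⟨rfl, ht, rfl⟩, ?_⟩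
  rintro g ρ₁ - _ _ ⟨i, j, rfl, rfl⟩
  cases hd : t.dir
  all_goals
    dsimp only
    rw [Proc.subst_inp]
    refine typed_inp.2 ⟨rfl, .read t _, ⟨rfl, _, rfl, by rw [hd]; rfl⟩, ?_⟩
    rintro h ρ₂ hh _ _ ⟨k, rfl, hk, rfl⟩
    rw [hd] at hk ⊢
    rw [Proc.subst_lift_cons (n := 2) rfl, Proc.subst_res, Proc.subst_par, dispatch_subst]
  · refine typed_res.2 ⟨Stream'.cons t.write (ρ₁ j), typed_par.2 (.inl ⟨?_, ?_⟩)⟩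
    · exact typed_dispatch (c := ⟨Tape.writeMove ⟨ρ₁ i, t.read, ρ₁ j⟩ t.write .left, t.dst⟩)
        (i := k + 1) (j := 0) hk rfl (by simp)
    · rw [Proc.subst_out, Proc.subst_nil]
      exact typed_out.2 ⟨⟨0, h j + 1, rfl, rfl, hh.eq j⟩, typed_nil.2 rfl⟩
  · refine typed_res.2 ⟨Stream'.cons t.write (ρ₁ i), typed_par.2 (.inl ⟨?_, ?_⟩)⟩
    · exact typed_dispatch (c := ⟨Tape.writeMove ⟨ρ₁ i, t.read, ρ₁ j⟩ t.write .right, t.dst⟩)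
        (i := 0) (j := k + 1) rfl hk (by simp)
    · rw [Proc.subst_out, Proc.subst_nil]
      exact typed_out.2 ⟨⟨0, h i + 1, rfl, rfl, hh.eq i⟩, typed_nil.2 rfl⟩

theorem typed_encodeTransitions : Typed name M (encodeTransitions name M) ρ none := by
  have (l : List (Transition S Q)) (hl : ∀ t ∈ l, t ∈ M.transitions) :
      Typed name M (Proc.parList (l.map fun t => (encodeTransition name t).repl)) ρ none := by
    induction l with
    | nil => exact typed_nil.2 rfl
    | cons t l ih =>
      have ht := typed_encodeTransition (name := name) (ρ := ρ) (hl t (by simp))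
      exact typed_par.2 (.inl ⟨typed_repl.2 ⟨ht, ht⟩, ih fun t h => hl t (by simp [h])⟩)
  exact this _ fun t h => Finset.mem_toList.1 h

theorem typed_encode (c : Config S Q) :
    Typed name M (encode name M c) ρ (some (.head c)) := by
  refine typed_res.2 ⟨c.tape.left, typed_res.2 ⟨c.tape.right, typed_par.2 (.inl ⟨?_,
    typed_encodeTransitions⟩)⟩⟩
  exact typed_par.2 (.inl ⟨typed_out.2 ⟨⟨rfl, 1, 0, rfl, rfl, rfl⟩, typed_nil.2 rfl⟩,
    typed_par.2 (.inl ⟨typed_chain (ρ := (ρ.push c.tape.left).push c.tape.right) 1,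
      typed_chain (ρ := (ρ.push c.tape.left).push c.tape.right) 0⟩)⟩)

/-- The only token with which the encoding of a configuration can be typed is the configuration
itself. -/
theorem eq_head_of_typed_encode {c : Config S Q} {x : Token S Q}
    (h : Typed name M (encode name M c) ρ (some x)) : x = .head c := by
  obtain ⟨sl, h⟩ := typed_res.1 h
  obtain ⟨sr, h⟩ := typed_res.1 h
  -- The announcement of the state is on a free channel, which is not a cell of a chain.
  have hout {l : List (Nm N)} {ρ : Ctx S} :
      ¬ Typed name M (Proc.out (chanName name c.state c.tape.head) l Proc.nil) ρ none := by
    intro h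
    obtain ⟨⟨i, j, hi, -⟩, -⟩ := typed_out.1 h
    cases hi
  obtain ⟨h, -⟩ | ⟨h, -⟩ := typed_par.1 h
  · obtain ⟨ho, hc⟩ | ⟨ho, -⟩ := typed_par.1 h
    · obtain ⟨hl, hr⟩ := (typed_par.1 hc).elim id id
      have el := eq_of_typed_chain hl
      have er := eq_of_typed_chain hr
      obtain ⟨ho, -⟩ := typed_out.1 ho
      rcases x with c' | _
      · obtain ⟨hq, i, j, hb, hi, hj⟩ := ho
        simp only [List.cons.injEq, Nm.bound.injEq, and_true] at hb
        obtain ⟨rfl, rfl⟩ := hb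
        rw [← el] at hi
        rw [← er] at hj
        have hq : c.state = c'.state ∧ c.tape.head = c'.tape.head := by
          simpa [chanName] using hq
        obtain ⟨⟨l, hd, r⟩, q⟩ := c
        obtain ⟨⟨l', hd', r'⟩, q'⟩ := c'
        simp_all
      · exact ho.elim
    · exact absurd ho hout
  · obtain ⟨ho, -⟩ := (typed_par.1 h).elim id id
    exact absurd ho hout

end TypedEncoding

/-! ### Parallel composition modulo structural congruence -/

section StructuralCongruence

variable {N : Type w} {P P' A A' B B' : Proc N}

theorem StructCong.refl (P : Proc N) : StructCong P P := CongUnder.refl ∅ P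

theorem StructCong.symm (h : StructCong A B) : StructCong B A := CongUnder.symm h

theorem StructCong.trans (h : StructCong P A) (h' : StructCong A B) : StructCong P B :=
  CongUnder.trans h h'

theorem StructCong.par (hA : StructCong A A') (hB : StructCong B B') :
    StructCong (A.par B) (A'.par B') :=
  (CongUnder.par_congr B hA).trans ((CongUnder.par_comm _ _ _).trans
    ((CongUnder.par_congr A' hB).trans (CongUnder.par_comm _ _ _)))

theorem StructCong.res (h : StructCong A B) : StructCong A.res B.res := by
  have hV : underRes ∅ = ∅ := by simp [underRes]
  exact CongUnder.res_congr (by rwa [hV])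

/-- Processes up to structural congruence. -/
instance Proc.setoid (N : Type w) : Setoid (Proc N) :=
  ⟨StructCong, StructCong.refl, StructCong.symm, StructCong.trans⟩

/-- The commutative monoid of processes up to structural congruence, under parallel composition. -/
instance Proc.commMonoid : CommMonoid (Quotient (Proc.setoid N)) where
  mul := Quotient.map₂ Proc.par fun _ _ h _ _ h' => StructCong.par h h'
  one := ⟦Proc.nil⟧
  mul_assoc := by
    rintro ⟨P⟩ ⟨Q⟩ ⟨R⟩
    exact Quotient.sound (CongUnder.symm (CongUnder.par_assoc _ P Q R))
  mul_comm := by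
    rintro ⟨P⟩ ⟨Q⟩
    exact Quotient.sound (CongUnder.par_comm _ P Q)
  mul_one := by
    rintro ⟨P⟩
    exact Quotient.sound (CongUnder.par_nil _ P)
  one_mul := by
    rintro ⟨P⟩
    exact Quotient.sound (CongUnder.trans (CongUnder.par_comm _ _ _) (CongUnder.par_nil _ P))

theorem mk_par (A B : Proc N) : (⟦A.par B⟧ : Quotient (Proc.setoid N)) = ⟦A⟧ * ⟦B⟧ := rfl

theorem mk_nil : (⟦Proc.nil⟧ : Quotient (Proc.setoid N)) = 1 := rfl

theorem structCong_iff : StructCong A B ↔ (⟦A⟧ : Quotient (Proc.setoid N)) = ⟦B⟧ :=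
  (Quotient.eq (r := Proc.setoid N)).symm

theorem StructCong.scope (A B : Proc N) : StructCong (A.par B.res) (A.weaken.par B).res :=
  CongUnder.scope ∅ A B

/-- A restriction of a name that does not occur may be dropped. -/
theorem StructCong.res_weaken (P : Proc N) : StructCong P.weaken.res P :=
  (StructCong.symm (CongUnder.par_nil ∅ P.weaken)).res.trans
    ((StructCong.scope P Proc.nil).symm.trans
      ((StructCong.par (.refl P) (CongUnder.res_nil ∅)).trans (CongUnder.par_nil ∅ P)))

theorem StructCong.res_comm (P : Proc N) : StructCong P.res.res (P.subst Nm.swap).res.res :=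
  CongUnder.res_comm ∅ P

theorem StructCong.res_res_comm (P : Proc N) :
    StructCong P.res.res.res (P.subst (Nm.lift 1 Nm.swap)).res.res.res := by
  have := StructCong.res_comm P.res
  rwa [Proc.subst_res] at this

end StructuralCongruence

/-! ### Simulation of a transition by two reductions -/

section Simulation

variable {S : Type u} {Q : Type v} {N : Type w} {name : S ⊕ Q × S ↪ N} {M : TuringMachine S Q}

/-- Once the symbol has been received, the conditional selects the output for this symbol. -/
theorem dispatch_structCong (q : Q) (a : S) (l r : Nm N) {ss : List S} (hs : a ∈ ss) :
    StructCong (dispatch name q (symName name a) l r ss)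
      (Proc.out (chanName name q a) [l, r] Proc.nil) := by
  induction ss with
  | nil => cases hs
  | cons s ss ih =>
    by_cases h : a = s
    · subst h
      exact CongUnder.ite_eq ∅ _ _ _
    · have hne : symName name a ≠ symName name s := by simpa [symName] using h
      exact (CongUnder.ite_ne _ _ hne trivial trivial).trans
        (ih ((List.mem_cons.1 hs).resolve_left h))

variable (name) in
/-- The chain with the entry channel `c` and the symbols `s`. -/
def symChain (c : Nm N) (s : Stream' S) : Proc N := chain c (s.map fun s => name (Sum.inl s))

variable (name) in
/-- One cell of a chain: on the channel `c`, the symbol `a` and the channel `d` of the next cell. -/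
def symCell (c : Nm N) (a : S) (d : Nm N) : Proc N := Proc.out c [symName name a, d] Proc.nil

variable (name) in
/-- The announcement of the state `q` and the scanned symbol `a`, with the entry channels of the
two sides of the tape. -/
def announce (q : Q) (a : S) (l r : Nm N) : Proc N :=
  Proc.out (chanName name q a) [l, r] Proc.nil

@[simp] theorem symChain_subst (c : Nm N) (s : Stream' S) (σ : ℕ → Nm N) :
    (symChain name c s).subst σ = symChain name (c.subst σ) s := subst_chain σ c _

@[simp] theorem symCell_subst (c d : Nm N) (a : S) (σ : ℕ → Nm N) :
    (symCell name c a d).subst σ = symCell name (c.subst σ) a (d.subst σ) := by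
  simp [symCell, symName]

@[simp] theorem announce_subst (q : Q) (a : S) (l r : Nm N) (σ : ℕ → Nm N) :
    (announce name q a l r).subst σ = announce name q a (l.subst σ) (r.subst σ) := by
  simp [announce, chanName]

theorem symChain_eq (c : Nm N) (s : Stream' S) : symChain name c s =
    ((symCell name (c.shift 1) s.head (Nm.bound 0)).par
      (symChain name (Nm.bound 0) s.tail)).res :=
  chain_unfold _ _

/-- An input on the entry channel of a chain receives the first symbol of the chain and the entry
channel of the rest. -/
theorem red_read (c : Nm N) (s : Stream' S) (A X : Proc N) :
    Red ((Proc.inp c 2 A).par ((symChain name c s).par X))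
      (((A.subst (Nm.lift 2 fun k => Nm.bound (k + 1))).subst
        (Nm.inst [symName name s.head, Nm.bound 0])).par
          ((symChain name (Nm.bound 0) s.tail).par X.weaken)).res := by
  have h : Red ((symCell name (c.shift 1) s.head (Nm.bound 0)).par
      (Proc.inp (c.shift 1) 2 (A.subst (Nm.lift 2 fun k => Nm.bound (k + 1))))) _ :=
    Red.comm _ [symName name s.head, Nm.bound 0] _ _
  refine .struct ?_ (.res (.par ((symChain name (Nm.bound 0) s.tail).par X.weaken) h))
    (StructCong.res ?_)
  · rw [symChain_eq]
    refine StructCong.trans (A := ((Proc.inp c 2 A).par X).par ((symCell name (c.shift 1) s.head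
      (Nm.bound 0)).par (symChain name (Nm.bound 0) s.tail)).res) ?_
        ((StructCong.scope _ _).trans (StructCong.res ?_))
    · rw [structCong_iff]
      simp only [mk_par]
      ac_rfl
    · rw [structCong_iff]
      simp only [Proc.weaken, Proc.subst_par, Proc.subst_inp, Nm.shift_eq_subst, mk_par]
      ac_rfl
  · rw [structCong_iff]
    simp only [mk_par, mk_nil, one_mul]

variable [Fintype S]

@[simp] theorem encodeTransition_subst (t : Transition S Q) (σ : ℕ → Nm N) :
    (encodeTransition name t).subst σ = encodeTransition name t := by
  rcases t with ⟨p, a, b, d, q⟩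
  cases d <;> simp [encodeTransition, dispatch_subst, symName, chanName, Nm.lift]

@[simp] theorem encodeTransitions_subst (σ : ℕ → Nm N) :
    (encodeTransitions name M).subst σ = encodeTransitions name M := by
  unfold encodeTransitions
  induction M.transitions.toList with
  | nil => exact Proc.subst_nil σ
  | cons t l ih =>
    simp only [Proc.parList, List.map_cons, List.foldr_cons] at ih ⊢
    rw [Proc.subst_par, ih, Proc.subst_repl, encodeTransition_subst]

/-- A replicated tuple provides a copy of itself. -/
theorem encodeTransitions_structCong {t : Transition S Q} (ht : t ∈ M.transitions) :
    StructCong (encodeTransitions name M)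
      ((encodeTransition name t).par (encodeTransitions name M)) := by
  have key (l : List (Transition S Q)) (h : t ∈ l) :
      StructCong (Proc.parList (l.map fun t => (encodeTransition name t).repl))
        ((encodeTransition name t).par
          (Proc.parList (l.map fun t => (encodeTransition name t).repl))) := by
    induction l with
    | nil => cases h
    | cons u l ih =>
      simp only [Proc.parList, List.map_cons, List.foldr_cons] at ih ⊢
      rcases List.mem_cons.1 h with rfl | h
      · refine (StructCong.par (CongUnder.unfold ∅ (encodeTransition name t)) (.refl _)).trans ?_
        exact CongUnder.symm (CongUnder.par_assoc _ _ _ _)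
      · refine (StructCong.par (.refl _) (ih h)).trans ?_
        rw [structCong_iff]
        simp only [mk_par]
        ac_rfl
  exact key _ (Finset.mem_toList.2 ht)

theorem encode_eq (c : Config S Q) : encode name M c =
    ((((announce name c.state c.tape.head (Nm.bound 1) (Nm.bound 0)).par
      ((symChain name (Nm.bound 1) c.tape.left).par
        (symChain name (Nm.bound 0) c.tape.right))).par (encodeTransitions name M))).res.res :=
  rfl

/-- The first reduction consumes the announcement and a copy of the tuple. -/
theorem red_encode {t : Transition S Q} (ht : t ∈ M.transitions) {c : Config S Q}
    (hq : t.src = c.state) (hs : t.read = c.tape.head) {A : Proc N}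
    (hA : encodeTransition name t = Proc.inp (chanName name t.src t.read) 2 A) :
    Red (encode name M c) ((Proc.nil.par (A.subst (Nm.inst [Nm.bound 1, Nm.bound 0]))).par
      (((symChain name (Nm.bound 1) c.tape.left).par
        (symChain name (Nm.bound 0) c.tape.right)).par (encodeTransitions name M))).res.res := by
  have h : Red ((announce name c.state c.tape.head (Nm.bound 1) (Nm.bound 0)).par
      (encodeTransition name t))
      (Proc.nil.par (A.subst (Nm.inst [Nm.bound 1, Nm.bound 0]))) := by
    rw [hA, hq, hs]
    exact Red.comm _ [Nm.bound 1, Nm.bound 0] _ A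
  rw [encode_eq]
  refine .struct (StructCong.res (StructCong.res ?_)) (.res (.res (.par _ h))) (.refl _)
  refine (StructCong.par (.refl _) (encodeTransitions_structCong ht)).trans ?_
  rw [structCong_iff]
  simp only [mk_par]
  ac_rfl

/-- The encoding of the configuration after a move to the left, with the cell that has been
written taken out of its chain. -/
theorem encode_cons_right (L R : Stream' S) (q : Q) (a w : S) :
    StructCong (encode name M ⟨⟨L, a, Stream'.cons w R⟩, q⟩)
      (((announce name q a (Nm.bound 2) (Nm.bound 1)).par
        (symCell name (Nm.bound 1) w (Nm.bound 0))).par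
          (((symChain name (Nm.bound 2) L).par (symChain name (Nm.bound 0) R)).par
            (encodeTransitions name M))).res.res.res := by
  rw [encode_eq]
  refine StructCong.res (StructCong.res (StructCong.trans
    (A := ((announce name q a (Nm.bound 1) (Nm.bound 0)).par
      ((symChain name (Nm.bound 1) L).par (encodeTransitions name M))).par
        (symChain name (Nm.bound 0) (Stream'.cons w R))) ?_ ?_))
  · rw [structCong_iff]
    simp only [mk_par]
    ac_rfl
  · rw [symChain_eq (Nm.bound 0)]
    refine (StructCong.scope _ _).trans (StructCong.res ?_)
    rw [structCong_iff]
    simp only [Proc.weaken, Proc.subst_par, announce_subst, symChain_subst,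
      encodeTransitions_subst, mk_par]
    simp
    ac_rfl

/-- The encoding of the configuration after a move to the right, with the cell that has been
written taken out of its chain. -/
theorem encode_cons_left (L R : Stream' S) (q : Q) (a w : S) :
    StructCong (encode name M ⟨⟨Stream'.cons w L, a, R⟩, q⟩)
      (((announce name q a (Nm.bound 2) (Nm.bound 1)).par
        (symCell name (Nm.bound 2) w (Nm.bound 0))).par
          (((symChain name (Nm.bound 0) L).par (symChain name (Nm.bound 1) R)).par
            (encodeTransitions name M))).res.res.res := by
  rw [encode_eq]
  refine StructCong.res (StructCong.res (StructCong.trans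
    (A := ((announce name q a (Nm.bound 1) (Nm.bound 0)).par
      ((symChain name (Nm.bound 0) R).par (encodeTransitions name M))).par
        (symChain name (Nm.bound 1) (Stream'.cons w L))) ?_ ?_))
  · rw [structCong_iff]
    simp only [mk_par]
    ac_rfl
  · rw [symChain_eq (Nm.bound 1)]
    refine (StructCong.scope _ _).trans (StructCong.res ?_)
    rw [structCong_iff]
    simp only [Proc.weaken, Proc.subst_par, announce_subst, symChain_subst,
      encodeTransitions_subst, mk_par]
    simp
    ac_rfl

theorem exists_red_red_left {t : Transition S Q} (ht : t ∈ M.transitions) {c : Config S Q}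
    (hq : t.src = c.state) (hs : t.read = c.tape.head) (hd : t.dir = .left) :
    ∃ P₁ P₂ : Proc N, Red (encode name M c) P₁ ∧ Red P₁ P₂ ∧
      StructCong P₂ (encode name M ⟨c.tape.writeMove t.write t.dir, t.dst⟩) := by
  have h₁ := red_encode (name := name) ht hq hs rfl
  obtain ⟨⟨L, h, R⟩, p⟩ := c
  rw [hd] at h₁ ⊢
  have h₂ := red_read (name := name) (Nm.bound 1) L
    (((dispatch name t.dst (Nm.bound 1) (Nm.bound 2) (Nm.bound 0) Finset.univ.toList).par
      (symCell name (Nm.bound 0) t.write (Nm.bound 3))).res)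
    ((symChain name (Nm.bound 0) R).par (encodeTransitions name M))
  refine ⟨_, _, h₁, .struct (StructCong.res (StructCong.res ?_)) (.res (.res h₂)) (.refl _), ?_⟩
  · rw [structCong_iff]
    simp [dispatch_subst, mk_par, mk_nil, symName, symCell, Nm.lift, Nm.inst]
    ac_rfl
  · refine .trans ?_ (encode_cons_right _ _ _ _ _).symm
    let B : Proc N := ((announce name t.dst L.head (Nm.bound 1) (Nm.bound 0)).par
      (symCell name (Nm.bound 0) t.write (Nm.bound 2))).par
        (((symChain name (Nm.bound 1) L.tail).par (symChain name (Nm.bound 2) R)).par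
          (encodeTransitions name M))
    -- The restricted name of the written cell is moved outwards, and the symbol is dispatched.
    have hB : StructCong (((((dispatch name t.dst (symName name L.head) (Nm.bound 1) (Nm.bound 0)
        Finset.univ.toList).par (symCell name (Nm.bound 0) t.write (Nm.bound 2))).res).par
          ((symChain name (Nm.bound 0) L.tail).par ((symChain name (Nm.bound 1) R).par
            (encodeTransitions name M)))).res.res.res) B.res.res.res.res := by
      refine StructCong.res (StructCong.res (StructCong.res ?_))
      refine .trans (CongUnder.par_comm _ _ _) ((StructCong.scope _ _).trans (StructCong.res ?_))
      refine (StructCong.par (.refl _) (StructCong.par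
        (dispatch_structCong _ _ _ _ (Finset.mem_toList.2 (Finset.mem_univ _))) (.refl _))).trans ?_
      rw [structCong_iff]
      simp [Proc.weaken, B, announce, mk_par]
      ac_rfl
    -- The entry channel of the consumed cell does not occur any more.
    have hW : B.res.res.res = B.res.res.res.weaken := by simp [B, Proc.weaken, Nm.lift]
    simp [Proc.weaken, dispatch_subst, symName, Nm.lift, Nm.inst] at hB ⊢
    refine hB.trans ?_
    rw [hW]
    refine (StructCong.res_weaken _).trans ((StructCong.res_res_comm B).trans
      ((StructCong.res (StructCong.res_comm _)).trans ?_))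
    simpa [B, Nm.lift, Nm.swap] using StructCong.refl _

theorem exists_red_red_right {t : Transition S Q} (ht : t ∈ M.transitions) {c : Config S Q}
    (hq : t.src = c.state) (hs : t.read = c.tape.head) (hd : t.dir = .right) :
    ∃ P₁ P₂ : Proc N, Red (encode name M c) P₁ ∧ Red P₁ P₂ ∧
      StructCong P₂ (encode name M ⟨c.tape.writeMove t.write t.dir, t.dst⟩) := by
  have h₁ := red_encode (name := name) ht hq hs rfl
  obtain ⟨⟨L, h, R⟩, p⟩ := c
  rw [hd] at h₁ ⊢
  have h₂ := red_read (name := name) (Nm.bound 0) R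
    (((dispatch name t.dst (Nm.bound 1) (Nm.bound 0) (Nm.bound 2) Finset.univ.toList).par
      (symCell name (Nm.bound 0) t.write (Nm.bound 4))).res)
    ((symChain name (Nm.bound 1) L).par (encodeTransitions name M))
  refine ⟨_, _, h₁, .struct (StructCong.res (StructCong.res ?_)) (.res (.res h₂)) (.refl _), ?_⟩
  · rw [structCong_iff]
    simp [dispatch_subst, mk_par, mk_nil, symName, symCell, Nm.lift, Nm.inst]
    ac_rfl
  · refine .trans ?_ (encode_cons_left _ _ _ _ _).symm
    let B : Proc N := ((announce name t.dst R.head (Nm.bound 0) (Nm.bound 1)).par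
      (symCell name (Nm.bound 0) t.write (Nm.bound 3))).par
        (((symChain name (Nm.bound 3) L).par (symChain name (Nm.bound 1) R.tail)).par
          (encodeTransitions name M))
    -- The restricted name of the written cell is moved outwards, and the symbol is dispatched.
    have hB : StructCong (((((dispatch name t.dst (symName name R.head) (Nm.bound 0) (Nm.bound 1)
        Finset.univ.toList).par (symCell name (Nm.bound 0) t.write (Nm.bound 3))).res).par
          ((symChain name (Nm.bound 0) R.tail).par ((symChain name (Nm.bound 2) L).par
            (encodeTransitions name M)))).res.res.res) B.res.res.res.res := by
      refine StructCong.res (StructCong.res (StructCong.res ?_))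
      refine .trans (CongUnder.par_comm _ _ _) ((StructCong.scope _ _).trans (StructCong.res ?_))
      refine (StructCong.par (.refl _) (StructCong.par
        (dispatch_structCong _ _ _ _ (Finset.mem_toList.2 (Finset.mem_univ _))) (.refl _))).trans ?_
      rw [structCong_iff]
      simp [Proc.weaken, B, announce, mk_par]
      ac_rfl
    let B' : Proc N := ((announce name t.dst R.head (Nm.bound 0) (Nm.bound 1)).par
      (symCell name (Nm.bound 0) t.write (Nm.bound 2))).par
        (((symChain name (Nm.bound 2) L).par (symChain name (Nm.bound 1) R.tail)).par
          (encodeTransitions name M))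
    -- The entry channel of the consumed cell, which does not occur any more, is moved to the front.
    have hW : (B.res.subst (Nm.lift 1 Nm.swap)).res.res = B'.res.res.res.weaken := by
      simp [B, B', Proc.weaken, Nm.lift, Nm.swap]
    simp [Proc.weaken, dispatch_subst, symName, Nm.lift, Nm.inst] at hB ⊢
    refine hB.trans ((StructCong.res_res_comm B.res).trans ?_)
    rw [hW]
    refine (StructCong.res_weaken _).trans ((StructCong.res_comm _).trans ?_)
    rw [Proc.subst_res]
    refine (StructCong.res (StructCong.res_comm _)).trans ((StructCong.res_res_comm _).trans ?_)
    simpa [B', Nm.lift, Nm.swap] using StructCong.refl _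

end Simulation

/-! ### Correspondence of computations -/

/-- A property that is never stuck yields an infinite sequence of steps. -/
theorem Diverges.of_invariant {α : Type*} {R : α → α → Prop} {I : α → Prop}
    (step : ∀ a, I a → ∃ b, R a b ∧ I b) {a : α} (ha : I a) : Diverges R a := by
  choose f hf using fun x : {a // I a} =>
    let ⟨b, hb, hb'⟩ := step x.1 x.2
    (⟨⟨b, hb'⟩, hb⟩ : ∃ y : {a // I a}, R x.1 y.1)
  refine ⟨fun n => (f^[n] ⟨a, ha⟩).1, rfl, fun n => ?_⟩
  simp only [Function.iterate_succ_apply']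
  exact hf _

theorem Diverges.exists_step {α : Type*} {R : α → α → Prop} {a : α} (h : Diverges R a) :
    ∃ b, R a b ∧ Diverges R b :=
  let ⟨f, h₀, hf⟩ := h
  ⟨f 1, h₀ ▸ hf 0, fun n => f (n + 1), rfl, fun n => hf (n + 1)⟩

section Correspondence

variable {S : Type u} {Q : Type v} {N : Type w} {name : S ⊕ Q × S ↪ N} {M : TuringMachine S Q}

/-- Any two successive reductions from a process that is typed like the encoding of `c` arrive at a
process that is typed like the encoding of a successor of `c`. -/
theorem exists_step_of_red_red {ρ : Ctx S} {P P₁ P₂ : Proc N} {c : Config S Q}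
    (h : Typed name M P ρ (some (.head c))) (h₁ : Red P P₁) (h₂ : Red P₁ P₂) :
    ∃ c', M.Step c c' ∧ Typed name M P₂ ρ (some (.head c')) := by
  obtain ⟨_, ⟨ht, hq, hs⟩, h⟩ := h₁.typed h
  obtain ⟨_, ⟨⟩, h⟩ := h₂.typed h
  exact ⟨_, ⟨_, ht, hq, hs, rfl⟩, h⟩

theorem StructCong.red {P P' R : Proc N} (h : StructCong P P') (hR : Red P' R) : Red P R :=
  .struct h hR (.refl R)

variable [Fintype S]

/-- A transition is simulated by two reductions. -/
theorem TuringMachine.Step.exists_red {c c' : Config S Q} (h : M.Step c c') :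
    ∃ P₁ P₂ : Proc N, Red (encode name M c) P₁ ∧ Red P₁ P₂ ∧ StructCong P₂ (encode name M c') := by
  obtain ⟨t, ht, hq, hs, rfl⟩ := h
  cases hd : t.dir
  · exact hd ▸ exists_red_red_left ht hq hs hd
  · exact hd ▸ exists_red_red_right ht hq hs hd

end Correspondence

end PiTM

theorem mainTheorem5 {S Q N : Type*} [Fintype S] (name : S ⊕ Q × S ↪ N)
    (M : PiTM.TuringMachine S Q) (c : PiTM.Config S Q) :
    (∀ c' : PiTM.Config S Q, M.Step c c' ↔
      ∃ P₁ P₂ : PiTM.Proc N, PiTM.Red (PiTM.encode name M c) P₁ ∧ PiTM.Red P₁ P₂ ∧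
        PiTM.StructCong P₂ (PiTM.encode name M c')) ∧
    (PiTM.Diverges M.Step c ↔ PiTM.Diverges PiTM.Red (PiTM.encode name M c)) ∧
    (∀ P : PiTM.Proc N, PiTM.Red (PiTM.encode name M c) P →
      ∀ c' : PiTM.Config S Q, ¬ PiTM.StructCong P (PiTM.encode name M c')) := by
  open PiTM in
  -- Encodings are typed in every context.
  let ρ : Ctx S := fun _ => c.tape.left
  refine ⟨fun c' => ⟨fun h => h.exists_red, ?_⟩, ⟨fun h => ?_, fun h => ?_⟩, fun P h c' e => ?_⟩
  · rintro ⟨P₁, P₂, h₁, h₂, e⟩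
    obtain ⟨c'', hc, h⟩ := exists_step_of_red_red (ρ := ρ) (typed_encode c) h₁ h₂
    cases eq_head_of_typed_encode (e.typed_iff.1 h)
    exact hc
  -- The invariant also covers the process between the two reductions of a transition.
  · refine Diverges.of_invariant (I := fun P => ∃ c, Diverges M.Step c ∧
      (StructCong P (encode name M c) ∨ ∃ P₂, Red P P₂ ∧ StructCong P₂ (encode name M c))) ?_
      ⟨c, h, .inl (.refl _)⟩
    rintro P ⟨c, hc, e | ⟨P₂, h, e⟩⟩
    · obtain ⟨c', hcc', hc'⟩ := hc.exists_step
      obtain ⟨P₁, P₂, h₁, h₂, e'⟩ := hcc'.exists_red (name := name)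
      exact ⟨P₁, e.red h₁, c', hc', .inr ⟨P₂, h₂, e'⟩⟩
    · exact ⟨P₂, h, c, hc, .inl e⟩
  · refine Diverges.of_invariant (I := fun c => ∃ P : Proc N, Diverges Red P ∧
      Typed name M P ρ (some (.head c))) ?_ ⟨_, h, typed_encode c⟩
    rintro c ⟨P, hP, hc⟩
    obtain ⟨P₁, h₁, hP₁⟩ := hP.exists_step
    obtain ⟨P₂, h₂, hP₂⟩ := hP₁.exists_step
    obtain ⟨c', hcc', h'⟩ := exists_step_of_red_red hc h₁ h₂
    exact ⟨c', hcc', P₂, hP₂, h'⟩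
  · obtain ⟨τ, ⟨-, -, -⟩, hP⟩ := h.typed (ρ := ρ) (typed_encode c)
    cases eq_head_of_typed_encode (e.typed_iff.1 hP)
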